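/- Conventions. Signatures are finite and multisorted: finitely many types and finitely many relational symbols, each with an arity that is a finite tuple of types. Structures and homomorphisms are typed, and $X\to Y$ means that there is a homomorphism from $X$ to $Y$. A *promise template* is a pair $(A,A')$ of structures of the same signature with $A\to A'$, where $A$ is finite and $A'$ may be infinite, such that some finite structure $X$ satisfies $X\not\to A'$. An instance of $\mathrm{PCSP}(A,A')$ is a finite structure $X$ of the same signature; it is positive if $X\to A$ and negative if $X\not\to A'$. A *reduction* from $\mathrm{PCSP}(A,A')$ to $\mathrm{PCSP}(B,B')$ is a map $\psi$ of structures such that, for all instances $X$, $X\to A$ implies $\psi(X)\to B$, and $X\not\to A'$ implies $\psi(X)\not\to B'$. *Datalog reductions.* A Datalog program over a signature $\Pi$ has finitely many typed rules whose bodies are lists of relational atoms and equalities, whose heads are atoms of auxiliary symbols, and a designated output symbol; its output is the relation of that symbol in the least fixed point. A Datalog interpretation from $\Pi$ to $\Delta$ consists of a program $\phi_t$ for each $\Delta$-type $t$ and a program $\phi_R$ for each $\Delta$-symbol $R$, the arity of $\phi_R$ being the concatenation of the arities of $\phi_t$ for the entries $t$ of the arity of $R$; it maps $X$ to the structure with domains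 $\phi_t(X)$ and relations given by $\phi_R(X)$. A union gadget from $\Delta$ to $\Sigma$ is a map of types together with a compatible map of symbols; it replaces the domains and relations by the disjoint unions of those with the same image. Write $\mathrm{PCSP}(A,A')\le_{\mathrm{DL}}\mathrm{PCSP}(B,B')$ if some composition $\upsilon\circ\phi$ of a union gadget $\upsilon$ with a Datalog interpretation $\phi$ (over some finite intermediate signature) is a reduction. *Consistency reductions.* For $k\ge 1$ and $X$ of the signature of $A$, let $(\mathcal F_K)_{K\subseteq X,\,|K|\le k}$ be the largest system of sets of partial homomorphisms $K\to A$ such that, for all $L\subseteq K$, every element of $\mathcal F_L$ extends to an element of $\mathcal F_K$ and every element of $\mathcal F_K$ restricts to an element of $\mathcal F_L$ (the outcome of enforcing $k$-consistency). The $k$-consistency reduction maps $X$ to the disjoint union of the powers $B^{\mathcal F_K}$ in which, for all $L\subseteq K$ and $b\colon\mathcal F_L\to B$, the element $b$ of $B^{\mathcal F_L}$ is identified with the element $b\circ\rho$ of $B^{\mathcal F_K}$, where $\rho\colon\mathcal F_K\to\mathcal F_L$ is restriction. *Minions.* A minion $M$ is a functor from finite sets to sets, $X\mapsto M^{(X)}$,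 with $M^{(X)}=\emptyset$ if and only if $X=\emptyset$; for $\pi\colon X\to Y$ and $f\in M^{(X)}$ write $f^\pi\in M^{(Y)}$ for the image of $f$. The minion $\mathrm{Pol}(A,A')$ has as elements of arity $X$ the homomorphisms $A^X\to A'$, with $f^\pi(a)=f(a\circ\pi)$. The minion $\omega(M)$ has as elements of arity $X$ the pairs $(Z,f)$ with $Z\subseteq X$ and $f\in M^{(Z)}$, with $(Z,f)^\pi=(\pi(Z),f^{\pi|_Z})$. A $(d,r)$-*homomorphism* from $M$ to $N$ assigns to each $f\in M^{(X)}$ a non-empty set $\xi(f)\subseteq N^{(X)}$ of at most $d$ elements such that, whenever $t_0,\dots,t_r\in M$ and maps $\pi_{i,j}$ ($0\le i<j\le r$) satisfy $t_j=t_i^{\pi_{i,j}}$ for $i<j$ and $\pi_{i,l}=\pi_{j,l}\circ\pi_{i,j}$ for $i<j<l$, there are $i<j$, $g_i\in\xi(t_i)$ and $g_j\in\xi(t_j)$ with $g_j=g_i^{\pi_{i,j}}$. *Gap sequences.* Let $D$ be a structure and $d,r\ge 0$. Call natural numbers $k_0\ge\dots\ge k_r$ a *gap sequence* for $D$ and $d$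 if every finite structure $X$ (of the signature of $D$) with the following property satisfies $X\to D$: there are sets $\mathcal I_i(U)$ ($0\le i\le r$, $U\subseteq X$, $|U|\le k_i$), each consisting of at most $d$ partial homomorphisms $U\to D$, such that for all $U_0\supseteq\dots\supseteq U_r$ with $|U_i|\le k_i$ there are $i<j$ and $f\in\mathcal I_i(U_i)$ with $f|_{U_j}\in\mathcal I_j(U_j)$. **Statement.** Let $(A,A')$ and $(B,B')$ be promise templates, and suppose that for some $d$ and $r$ there is a $(d,r)$-homomorphism from $\omega(\mathrm{Pol}(B,B'))$ to $\mathrm{Pol}(A,A')$. Then $\mathrm{PCSP}(A,A')\le_{\mathrm{DL}}\mathrm{PCSP}(B,B')$. Moreover, there is a gap sequence $k_0\ge\dots\ge k_r$ for $A'$ and $d$ with $k_0\ge 1$, and for every such sequence the $k_0$-consistency reduction is a reduction from $\mathrm{PCSP}(A,A')$ to $\mathrm{PCSP}(B,B')$. -/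

import Mathlib

universe u v w

namespace PCSPReductions

/-! ## Multisorted relational structures -/

/-- An arity over a set `T` of types: a finite tuple of types. -/
structure Arity (T : Type) where
  /-- the length of the tuple -/
  len : ℕ
  /-- the entries of the tuple -/
  typ : Fin len → T

/-- The tuples of arity `α` over a `T`-indexed family of sets. -/
abbrev Tuple {T : Type} (A : T → Type u) (α : Arity T) : Type u :=
  ∀ i : Fin α.len, A (α.typ i)

/-- Component-wise application of a type-preserving map. -/
def Tuple.map {T : Type} {A : T → Type u} {B : T → Type v} (f : ∀ t, A t → B t)
    {α : Arity T} (a : Tuple A α) : Tuple B α :=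
  fun i => f (α.typ i) (a i)

/-- Transport of a tuple along an equality of arities. -/
def Tuple.cast {T : Type} {A : T → Type u} {α β : Arity T} (h : α = β) (a : Tuple A α) :
    Tuple A β :=
  h ▸ a

/-- A finite multisorted relational signature. -/
structure Sig where
  /-- the types (sorts) -/
  Ty : Type
  /-- the relational symbols -/
  Sym : Type
  finite_ty : Finite Ty
  finite_sym : Finite Sym
  /-- the arity of a relational symbol -/
  ar : Sym → Arity Ty

/-- A relational structure of signature `S` (not necessarily finite). -/
structure Str (S : Sig) where
  /-- the domains, one for each type -/
  dom : S.Ty → Type u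
  /-- the relations, one for each symbol -/
  rel : ∀ R : S.Sym, Set (Tuple dom (S.ar R))

/-- The elements of a structure: elements of different types are different. -/
abbrev Str.Elem {S : Sig} (A : Str.{u} S) : Type u := Σ t : S.Ty, A.dom t

/-- A structure is finite if all its domains are finite (signatures are finite here). -/
def Str.IsFinite {S : Sig} (A : Str.{u} S) : Prop := ∀ t, Finite (A.dom t)

/-- Homomorphisms of structures. -/
structure Hom {S : Sig} (A : Str.{u} S) (B : Str.{v} S) where
  /-- the maps, one for each type -/
  map : ∀ t, A.dom t → B.dom t
  map_rel : ∀ (R : S.Sym) (a : Tuple A.dom (S.ar R)), a ∈ A.rel R → Tuple.map map a ∈ B.rel R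

/-- `A → B`: there is a homomorphism from `A` to `B`. -/
def HomTo {S : Sig} (A : Str.{u} S) (B : Str.{v} S) : Prop := Nonempty (Hom A B)

/-- The `X`-fold power of a structure. -/
def Str.pow {S : Sig} (B : Str.{u} S) (X : Type v) : Str.{max u v} S where
  dom t := X → B.dom t
  rel R := {b | ∀ x : X, (fun i => b i x) ∈ B.rel R}

/-- A promise template `(A, A')`: a pair of structures with `A → A'`, where `A` is finite (and `A'`
may be infinite), such that the promise CSP of the template has a negative instance. -/
structure PromiseTemplate (S : Sig) where
  /-- the structure `A` defining the positive instances -/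
  yes : Str.{0} S
  /-- the structure `A'` defining the negative instances -/
  no : Str.{u} S
  finite_yes : yes.IsFinite
  homTo : HomTo yes no
  exists_negative : ∃ X : Str.{0} S, X.IsFinite ∧ ¬ HomTo X no

/-- The map `ψ` is a reduction from the promise CSP of `T` to the promise CSP of `T'`: on all
(finite) instances it is complete and sound. -/
def IsReduction {S S' : Sig} (ψ : Str.{0} S → Str.{0} S')
    (T : PromiseTemplate.{u} S) (T' : PromiseTemplate.{v} S') : Prop :=
  ∀ X : Str.{0} S, X.IsFinite →
    (HomTo X T.yes → HomTo (ψ X) T'.yes) ∧ (¬ HomTo X T.no → ¬ HomTo (ψ X) T'.no)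

/-! ## Datalog -/

/-- An atomic formula over relational symbols `Rel` of arities `ar`, in which `V t` is the set of
variables of type `t`. -/
inductive Atom {T : Type} {Rel : Type} (ar : Rel → Arity T) (V : T → Type) : Type
  /-- a relational atom `R(x₁, …, xₙ)` -/
  | rel (R : Rel) (x : Tuple V (ar R)) : Atom ar V
  /-- an equality of two variables of the same type -/
  | eq (t : T) (x y : V t) : Atom ar V

/-- Truth of an atomic formula when the symbols are interpreted by `I` and the variables by `h`. -/
def Atom.Holds {T : Type} {Rel : Type} {ar : Rel → Arity T} {V : T → Type} {A : T → Type u}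
    (I : ∀ R, Set (Tuple A (ar R))) (h : ∀ t, V t → A t) : Atom ar V → Prop
  | .rel R x => Tuple.map h x ∈ I R
  | .eq t x y => h t x = h t y

/-- The arities of the symbols of a signature together with further (IDB) symbols. -/
def extArity (S : Sig) {idb : Type} (idbAr : idb → Arity S.Ty) : S.Sym ⊕ idb → Arity S.Ty
  | .inl R => S.ar R
  | .inr P => idbAr P

/-- A Datalog rule. The rule has the variables `Fin (vars t)` of type `t`, and its head is an atom
of an IDB symbol. (Listing a variable that occurs in no atom amounts to having `x = x` in the
body.) -/
structure DatalogRule (S : Sig) {idb : Type} (idbAr : idb → Arity S.Ty) where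
  /-- the number of variables of each type -/
  vars : S.Ty → ℕ
  /-- the symbol of the head -/
  headSym : idb
  /-- the arguments of the head -/
  headArgs : Tuple (fun t => Fin (vars t)) (idbAr headSym)
  /-- the body -/
  body : List (Atom (extArity S idbAr) (fun t => Fin (vars t)))

/-- A Datalog program with input signature `S`. -/
structure DatalogProgram (S : Sig) where
  /-- the IDB symbols -/
  idb : Type
  finite_idb : Finite idb
  /-- their arities -/
  idbAr : idb → Arity S.Ty
  /-- the rules -/
  rules : List (DatalogRule S idbAr)
  /-- the output symbol -/
  out : S.Sym ⊕ idb

namespace DatalogProgram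

variable {S : Sig}

/-- The arity of a Datalog program is the arity of its output symbol. -/
def arity (P : DatalogProgram S) : Arity S.Ty := extArity S P.idbAr P.out

/-- The interpretation of all symbols given by the input structure and relations for the IDBs. -/
def interp (P : DatalogProgram S) (A : Str.{u} S)
    (I : ∀ p : P.idb, Set (Tuple A.dom (P.idbAr p))) :
    ∀ s : S.Sym ⊕ P.idb, Set (Tuple A.dom (extArity S P.idbAr s))
  | .inl R => A.rel R
  | .inr p => I p

/-- The relations `I` are closed under the rules of the program. -/
def IsClosedUnder (P : DatalogProgram S) (A : Str.{u} S)
    (I : ∀ p : P.idb, Set (Tuple A.dom (P.idbAr p))) : Prop :=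
  ∀ ρ ∈ P.rules, ∀ h : (∀ t, Fin (ρ.vars t) → A.dom t),
    (∀ a ∈ ρ.body, a.Holds (P.interp A I) h) → Tuple.map h ρ.headArgs ∈ I ρ.headSym

/-- The fixed point of the program: the least IDB relations closed under the rules. -/
def fixpoint (P : DatalogProgram S) (A : Str.{u} S) (p : P.idb) :
    Set (Tuple A.dom (P.idbAr p)) :=
  {a | ∀ I, P.IsClosedUnder A I → a ∈ I p}

/-- The output relation of the program. -/
def eval (P : DatalogProgram S) (A : Str.{u} S) : Set (Tuple A.dom P.arity) :=
  P.interp A (P.fixpoint A) P.out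

end DatalogProgram

/-- The concatenation of the arities `β (α₁), …, β (αₙ)`. -/
def Arity.concat {T T' : Type} (α : Arity T') (β : T' → Arity T) : Arity T where
  len := ∑ i, (β (α.typ i)).len
  typ p := (β (α.typ (finSigmaFinEquiv.symm p).1)).typ (finSigmaFinEquiv.symm p).2

/-- The concatenation of a tuple of tuples. -/
def Tuple.concat {T T' : Type} {A : T → Type u} {α : Arity T'} {β : T' → Arity T}
    (a : ∀ i : Fin α.len, Tuple A (β (α.typ i))) : Tuple A (α.concat β) :=
  fun p => a (finSigmaFinEquiv.symm p).1 (finSigmaFinEquiv.symm p).2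

/-- A Datalog interpretation mapping `S`-structures to `S'`-structures. -/
structure DatalogInterpretation (S S' : Sig) where
  /-- the program defining the domain of a type -/
  dom : S'.Ty → DatalogProgram S
  /-- the program defining the relation of a symbol -/
  rel : S'.Sym → DatalogProgram S
  arity_rel : ∀ R, (rel R).arity = (S'.ar R).concat (fun t => (dom t).arity)

/-- The application of a Datalog interpretation to a structure. -/
def DatalogInterpretation.apply {S S' : Sig} (φ : DatalogInterpretation S S') (A : Str.{u} S) :
    Str.{u} S' where
  dom t := {a : Tuple A.dom (φ.dom t).arity // a ∈ (φ.dom t).eval A}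
  rel R := {a | Tuple.cast (φ.arity_rel R).symm
      (Tuple.concat (β := fun t => (φ.dom t).arity) (fun i => (a i).1)) ∈ (φ.rel R).eval A}

/-! ## Union gadgets and Datalog reductions with disjoint unions -/

/-- The image of a tuple of types under a map of types. -/
def Arity.map {T T' : Type} (d : T → T') (α : Arity T) : Arity T' where
  len := α.len
  typ i := d (α.typ i)

/-- A union gadget from `S`-structures to `S'`-structures. -/
structure UnionGadget (S S' : Sig) where
  /-- the map of types -/
  d : S.Ty → S'.Ty
  /-- the map of symbols -/
  r : S.Sym → S'.Sym
  arity_r : ∀ R, (S.ar R).map d = S'.ar (r R)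

/-- The domain of type `t` of the output of a union gadget: the disjoint union of the domains of the
types that are mapped to `t`. -/
def UnionGadget.Dom {S S' : Sig} (υ : UnionGadget S S') (A : Str.{u} S) (t : S'.Ty) : Type u :=
  Σ s : {s : S.Ty // υ.d s = t}, A.dom s.1

/-- The relations of the output of a union gadget: the unions of the relations of the symbols that
are mapped to the given one. -/
inductive UnionGadget.Rel {S S' : Sig} (υ : UnionGadget S S') (A : Str.{u} S) :
    ∀ R' : S'.Sym, Tuple (υ.Dom A) (S'.ar R') → Prop
  | intro (R : S.Sym) (a : Tuple A.dom (S.ar R)) (ha : a ∈ A.rel R) :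
      UnionGadget.Rel υ A (υ.r R) (Tuple.cast (υ.arity_r R)
        (fun i : Fin ((S.ar R).map υ.d).len => (⟨⟨(S.ar R).typ i, rfl⟩, a i⟩ :
          υ.Dom A (((S.ar R).map υ.d).typ i))))

/-- The application of a union gadget to a structure. -/
def UnionGadget.apply {S S' : Sig} (υ : UnionGadget S S') (A : Str.{u} S) : Str.{u} S' where
  dom := υ.Dom A
  rel R' := {b | υ.Rel A R' b}

/-- The promise CSP of `T` reduces to the promise CSP of `T'` by a composition of a union gadget
with a Datalog interpretation. -/
def DLReduces {S S' : Sig} (T : PromiseTemplate.{u} S) (T' : PromiseTemplate.{v} S') : Prop :=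
  ∃ (Δ : Sig) (φ : DatalogInterpretation S Δ) (υ : UnionGadget Δ S'),
    IsReduction (fun X => υ.apply (φ.apply X)) T T'

/-! ## The consistency reduction -/

/-- The type-preserving maps from a set `K` of elements of `X` to `A`. -/
abbrev Assignment {S : Sig} (X : Str.{u} S) (A : Str.{v} S) (K : Finset X.Elem) : Type (max u v) :=
  ∀ x : {x : X.Elem // x ∈ K}, A.dom x.1.1

/-- Restriction of an assignment to a subset. -/
def Assignment.restrict {S : Sig} {X : Str.{u} S} {A : Str.{v} S} {K L : Finset X.Elem}
    (h : L ⊆ K) (f : Assignment X A K) : Assignment X A L :=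
  fun x => f ⟨x.1, h x.2⟩

/-- An assignment on `K` is a partial homomorphism if it preserves all the relations between
elements of `K`. -/
def IsPartialHom {S : Sig} (X : Str.{u} S) (A : Str.{v} S) {K : Finset X.Elem}
    (f : Assignment X A K) : Prop :=
  ∀ (R : S.Sym) (a : Tuple X.dom (S.ar R)), a ∈ X.rel R →
    ∀ hK : ∀ i, (⟨(S.ar R).typ i, a i⟩ : X.Elem) ∈ K,
      (fun i => f ⟨⟨(S.ar R).typ i, a i⟩, hK i⟩) ∈ A.rel R

/-- The sets of at most `k` elements of `X`. -/
abbrev SmallSet {S : Sig} (X : Str.{u} S) (k : ℕ) : Type u := {K : Finset X.Elem // K.card ≤ k}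

/-- A consistent system of sets of partial homomorphisms on the at most `k`-element sets: for
`L ⊆ K`, each `h ∈ G L` extends to some `g ∈ G K`, and each `g ∈ G K` restricts to an element of
`G L`. -/
def IsConsistentSystem {S : Sig} (k : ℕ) (X : Str.{u} S) (A : Str.{v} S)
    (G : ∀ K : SmallSet X k, Set (Assignment X A K.1)) : Prop :=
  (∀ K, ∀ f ∈ G K, IsPartialHom X A f) ∧
  ∀ (L K : SmallSet X k) (hLK : L.1 ⊆ K.1),
    (∀ h ∈ G L, ∃ g ∈ G K, Assignment.restrict hLK g = h) ∧
    (∀ g ∈ G K, Assignment.restrict hLK g ∈ G L)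

/-- The result `𝓕 K` of enforcing `k`-consistency. Starting with all partial homomorphisms and
repeatedly removing those that violate consistency leaves exactly the largest consistent system,
i.e., the union of all consistent systems. -/
def kConsistency {S : Sig} (k : ℕ) (X : Str.{u} S) (A : Str.{v} S) (K : SmallSet X k) :
    Set (Assignment X A K.1) :=
  {f | ∃ G, IsConsistentSystem k X A G ∧ f ∈ G K}

theorem isConsistentSystem_kConsistency {S : Sig} (k : ℕ) (X : Str.{u} S) (A : Str.{v} S) :
    IsConsistentSystem k X A (kConsistency k X A) := by
  refine ⟨?_, ?_⟩
  · rintro K f ⟨G, hG, hf⟩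
    exact hG.1 K f hf
  · intro L K hLK
    refine ⟨?_, ?_⟩
    · rintro h ⟨G, hG, hh⟩
      obtain ⟨g, hg, rfl⟩ := (hG.2 L K hLK).1 h hh
      exact ⟨g, ⟨G, hG, hg⟩, rfl⟩
    · rintro g ⟨G, hG, hg⟩
      exact ⟨G, hG, (hG.2 L K hLK).2 g hg⟩

/-- The restriction map `𝓕 K → 𝓕 L` for `L ⊆ K`. -/
def kConsistency.restrict {S : Sig} {k : ℕ} {X : Str.{u} S} {A : Str.{v} S} {L K : SmallSet X k}
    (hLK : L.1 ⊆ K.1) (f : kConsistency k X A K) : kConsistency k X A L :=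
  ⟨Assignment.restrict hLK f.1,
    ((isConsistentSystem_kConsistency k X A).2 L K hLK).2 f.1 f.2⟩

/-- The elements `(K; b)` of type `t` before identification: the disjoint union of the domains of
the powers of `B` with exponents `𝓕 K`. -/
abbrev ConsPre {S S' : Sig} (k : ℕ) (A : Str.{0} S) (B : Str.{0} S') (X : Str.{0} S) (t : S'.Ty) :
    Type :=
  Σ K : SmallSet X k, (B.pow (kConsistency k X A K)).dom t

/-- The pairs of elements to be identified: `(K; b ∘ ρ)` and `(L; b)` for `L ⊆ K`, where `ρ` is the
restriction map. -/
inductive ConsIdent {S S' : Sig} (k : ℕ) (A : Str.{0} S) (B : Str.{0} S') (X : Str.{0} S)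
    (t : S'.Ty) : ConsPre k A B X t → ConsPre k A B X t → Prop
  | glue (L K : SmallSet X k) (hLK : L.1 ⊆ K.1) (b : kConsistency k X A L → B.dom t) :
      ConsIdent k A B X t ⟨K, fun f => b (kConsistency.restrict hLK f)⟩ ⟨L, b⟩

/-- The output of the `k`-consistency reduction on `X`: the disjoint union of the powers of `B` with
exponents `𝓕 K`, modulo the equivalence relation generated by the identified pairs. -/
def consReduction {S S' : Sig} (k : ℕ) (A : Str.{0} S) (B : Str.{0} S') (X : Str.{0} S) :
    Str.{0} S' where
  dom t := Quot (ConsIdent k A B X t)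
  rel R := {y | ∃ (K : SmallSet X k) (b : Tuple (B.pow (kConsistency k X A K)).dom (S'.ar R)),
    b ∈ (B.pow (kConsistency k X A K)).rel R ∧ y = fun i => Quot.mk _ ⟨K, b i⟩}

/-- The promise CSP of `T` reduces to the promise CSP of `T'` by the `k`-consistency reduction. -/
def ConsReduces {S S' : Sig} (k : ℕ) (T : PromiseTemplate.{u} S) (T' : PromiseTemplate.{v} S') :
    Prop :=
  IsReduction (consReduction k T.yes T'.yes) T T'

/-! ## Minions -/

/-- An abstract minion: a functor from finite sets to sets such that exactly the empty set is mapped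
to the empty set. -/
structure Minion where
  /-- the elements of arity `X` -/
  obj : ∀ (X : Type) [Finite X], Type u
  /-- taking minors -/
  map : ∀ {X Y : Type} [Finite X] [Finite Y], (X → Y) → obj X → obj Y
  map_id : ∀ {X : Type} [Finite X] (f : obj X), map (id : X → X) f = f
  map_comp : ∀ {X Y Z : Type} [Finite X] [Finite Y] [Finite Z] (π : Y → Z) (σ : X → Y)
    (f : obj X), map π (map σ f) = map (π ∘ σ) f
  isEmpty_iff : ∀ (X : Type) [Finite X], IsEmpty (obj X) ↔ IsEmpty X

/-- The polymorphism minion of a promise template. -/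
def Pol {S : Sig} (T : PromiseTemplate.{u} S) : Minion.{u} where
  obj X _ := Hom (T.yes.pow X) T.no
  map π f :=
    { map := fun t b => f.map t (fun x => b (π x))
      map_rel := fun R b hb => f.map_rel R (fun i x => b i (π x)) (fun x => hb (π x)) }
  map_id _ := rfl
  map_comp _ _ _ := rfl
  isEmpty_iff X _ := by
    constructor
    · intro hE
      by_contra hX
      obtain ⟨x⟩ := not_isEmpty_iff.mp hX
      obtain ⟨h⟩ := T.homTo
      exact hE.false
        { map := fun t b => h.map t (b x)
          map_rel := fun R b hb => h.map_rel R (fun i => b i x) (hb x) }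
    · intro hX
      refine ⟨fun f => ?_⟩
      obtain ⟨Y, -, hY⟩ := T.exists_negative
      exact hY ⟨{ map := fun t _ => f.map t (fun x => isEmptyElim x)
                  map_rel := fun R _ _ => f.map_rel R (fun _ x => isEmptyElim x)
                    (fun x => isEmptyElim x) }⟩

/-- Two elements of `ω(M)` are equal if their sets agree and their second components agree along the
bijection of the sets. -/
theorem omega_ext (M : Minion.{u}) {X : Type} [Finite X] {Z Z' : Set X} (h : Z = Z')
    (f : M.obj Z) (f' : M.obj Z') (e : Z → Z') (he : ∀ z, (e z : X) = z) (hf : M.map e f = f') :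
    (⟨Z, f⟩ : Σ Z : Set X, M.obj Z) = ⟨Z', f'⟩ := by
  subst h
  have : e = id := funext fun z => Subtype.ext (he z)
  subst this
  rw [M.map_id] at hf
  rw [hf]

/-- The restriction `Z → π(Z)` of a map `π : X → Y` to a subset `Z` of `X`. -/
def imageRestrict {X Y : Type} (π : X → Y) (Z : Set X) : Z → (π '' Z : Set Y) :=
  fun z => ⟨π z.1, Set.mem_image_of_mem π z.2⟩

/-- The minion `ω(M)`, whose elements of arity `X` are the pairs `(Z, f)` with `Z ⊆ X` and `f` an
element of `M` of arity `Z`; the minor of `(Z, f)` along `π` is `(π(Z), f^(π|Z))`. -/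
def omega (M : Minion.{u}) : Minion.{u} where
  obj X _ := Σ Z : Set X, M.obj Z
  map π p := ⟨π '' p.1, M.map (imageRestrict π p.1) p.2⟩
  map_id := by
    rintro X _ ⟨Z, f⟩
    refine omega_ext M (Set.image_id Z) _ _ (fun z => ⟨z.1, by simpa using z.2⟩)
      (fun _ => rfl) ?_
    rw [M.map_comp]
    exact M.map_id f
  map_comp := by
    rintro X Y W _ _ _ π σ ⟨Z, f⟩
    refine omega_ext M (Set.image_image π σ Z) _ _
      (fun z => ⟨z.1, (Set.image_image π σ Z) ▸ z.2⟩) (fun _ => rfl) ?_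
    rw [M.map_comp, M.map_comp]
    rfl
  isEmpty_iff X _ := by
    rw [isEmpty_sigma]
    constructor
    · intro h
      by_contra hX
      have h1 := (M.isEmpty_iff _).mp (h Set.univ)
      obtain ⟨x⟩ := not_isEmpty_iff.mp hX
      exact h1.false ⟨x, Set.mem_univ x⟩
    · intro hX Z
      exact (M.isEmpty_iff _).mpr ⟨fun z => hX.false z.1⟩

/-- `ξ` is a `(d, r)`-homomorphism from `M` to `N`: it assigns to each element of `M` a non-empty
set of at most `d` elements of `N` of the same arity so that, for each chain of minors
`t₀, …, t_r` in `M` (with connecting maps `π i j`), there are `i < j` and elements of `ξ(t_i)` and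
`ξ(t_j)` the latter of which is the minor of the former along `π i j`. -/
structure IsDRHom (d r : ℕ) (M : Minion.{u}) (N : Minion.{v})
    (ξ : ∀ (X : Type) [Finite X], M.obj X → Set (N.obj X)) : Prop where
  nonempty : ∀ (X : Type) [Finite X] (f : M.obj X), (ξ X f).Nonempty
  card_le : ∀ (X : Type) [Finite X] (f : M.obj X), (ξ X f).encard ≤ d
  chain : ∀ (X : Fin (r + 1) → Type) [∀ i, Finite (X i)] (t : ∀ i, M.obj (X i))
    (π : ∀ i j : Fin (r + 1), i < j → X i → X j),
    (∀ (i j : Fin (r + 1)) (hij : i < j), t j = M.map (π i j hij) (t i)) →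
    (∀ (i j k : Fin (r + 1)) (hij : i < j) (hjk : j < k),
      π i k (hij.trans hjk) = π j k hjk ∘ π i j hij) →
    ∃ (i j : Fin (r + 1)) (hij : i < j), ∃ g ∈ ξ (X i) (t i), ∃ g' ∈ ξ (X j) (t j),
      g' = N.map (π i j hij) g

/-! ## Partial solution schemes -/

/-- The instance `X` of the CSP of `D` allows a consistent sequence of partial solution schemes of
arities `k 0, …, k r` and value `d`. -/
def AllowsConsistentSchemes {S : Sig} {r : ℕ} (X : Str.{u} S) (D : Str.{v} S)
    (k : Fin (r + 1) → ℕ) (d : ℕ) : Prop :=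
  ∃ I : ∀ (i : Fin (r + 1)) (U : SmallSet X (k i)), Set (Assignment X D U.1),
    (∀ i U, (I i U).encard ≤ d ∧ ∀ f ∈ I i U, IsPartialHom X D f) ∧
    ∀ (U : ∀ i, SmallSet X (k i)) (hU : ∀ i j, i ≤ j → (U j).1 ⊆ (U i).1),
      ∃ (i j : Fin (r + 1)) (hij : i < j), ∃ f ∈ I i (U i),
        Assignment.restrict (hU i j hij.le) f ∈ I j (U j)

/-- The arities `k 0 ≥ … ≥ k r` are as in the combinatorial gap theorem for the template `D` and the
value `d`: every instance that allows a consistent sequence of partial solution schemes of these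
arities and this value is solvable. -/
def IsGapSequence {S : Sig} {r : ℕ} (D : Str.{v} S) (d : ℕ) (k : Fin (r + 1) → ℕ) : Prop :=
  Antitone k ∧ ∀ X : Str.{0} S, X.IsFinite → AllowsConsistentSchemes X D k d → HomTo X D

end PCSPReductions

/-! Soundness of the consistency reduction. Given a homomorphism from its output on `X` to `B'`,
each power `B^{𝓕 K}` yields a polymorphism of `(B, B')` of arity `𝓕 K`, and the identifications say
that for `L ⊆ K` the polymorphism of `L` is the minor of that of `K` along restriction. Restriction
is onto, so this remains true in `ω` with full sets as first components. The `(d, r)`-homomorphism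
assigns to each of them at most `d` polymorphisms of `(A, A')` of arity `𝓕 K`; evaluated at the
projections `f ↦ f x`, these become partial homomorphisms `K → A'`, and the chain condition becomes
the consistency required of a gap sequence. Hence `X → A'` (`homTo_of_homTo_consReduction`).

Gap sequences exist by induction on `r` (`exists_isGapSequence`). Call a chain `U₁ ⊇ … ⊇ U_{r+1}` on
which the schemes after the first are inconsistent a test with base `U_{r+1}`. The at most `d`
functions of the first scheme on `V` must then pass all tests within `V`. By a sunflower argument
(`exists_holds_or_no_tests`), either local functions fit together to a homomorphism, or no test has
a base above some set `Z` of bounded size. In the latter case, replacing `U` by `U ∪ Z` and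
restricting back to `U` makes the later schemes a shorter consistent sequence.

For Datalog, the program of all rules of bounded width that are valid in `A` derives, for a listing
of `K`, enough to define a consistent system contained in `𝓕` (`ofTuple_mem_kConsistency`). Thus a
Datalog interpretation and a union gadget can produce the powers of `B`, but cannot identify
elements. Elements that should be identified do however occur in the same relations
(`PowElem.rel_iff_of_step`), so the consistency reduction maps homomorphically to the Datalog
output, and soundness carries over. -/

namespace PCSPReductions

/-! ## Sunflowers -/

/-- Every family of more than `sunflowerBound k n` sets of size at most `n` contains a sunflower with
`k` petals. -/
def sunflowerBound (k : ℕ) : ℕ → ℕ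
  | 0 => 1
  | n + 1 => k + k * (n + 1) * sunflowerBound k n

theorem exists_maximal_disjoint_subfamily {γ : Type u} [DecidableEq γ]
    (𝒮 : Finset (Finset γ)) :
    ∃ 𝒟 ⊆ 𝒮, (∀ s ∈ 𝒟, ∀ t ∈ 𝒟, s ≠ t → Disjoint s t) ∧
      ∀ s ∈ 𝒮, s ∉ 𝒟 → ∃ t ∈ 𝒟, ¬ Disjoint s t := by
  classical
  let Q := 𝒮.powerset.filter fun 𝒟 => ∀ s ∈ 𝒟, ∀ t ∈ 𝒟, s ≠ t → Disjoint s t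
  have hQ : Q.Nonempty := ⟨∅, by simp [Q]⟩
  obtain ⟨𝒟, h𝒟, hmax⟩ := Finset.exists_max_image Q Finset.card hQ
  obtain ⟨h𝒟𝒮, hdis⟩ := Finset.mem_filter.mp h𝒟
  rw [Finset.mem_powerset] at h𝒟𝒮
  refine ⟨𝒟, h𝒟𝒮, hdis, fun s hs hs𝒟 => ?_⟩
  by_contra! hcon
  have hmem : insert s 𝒟 ∈ Q := by
    refine Finset.mem_filter.mpr ⟨Finset.mem_powerset.mpr (Finset.insert_subset hs h𝒟𝒮), ?_⟩
    intro a ha b hb hab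
    rcases Finset.mem_insert.mp ha with rfl | ha1 <;> rcases Finset.mem_insert.mp hb with rfl | hb1
    · exact absurd rfl hab
    · exact hcon b hb1
    · exact (hcon a ha1).symm
    · exact hdis a ha1 b hb1 hab
  have := hmax _ hmem
  rw [Finset.card_insert_of_notMem hs𝒟] at this
  omega

/-- Take a maximal disjoint subfamily. If it has `k` members, they form a sunflower with empty core.
Otherwise its union has at most `k * (n + 1)` points, one of which lies in many sets; erase this
point from them and use induction. -/
theorem exists_sunflower {γ : Type u} [DecidableEq γ] (k n : ℕ) (𝒮 : Finset (Finset γ))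
    (hn : ∀ s ∈ 𝒮, s.card ≤ n) (hcard : sunflowerBound k n < 𝒮.card) :
    ∃ 𝒬 ⊆ 𝒮, 𝒬.card = k ∧ ∃ C, ∀ s ∈ 𝒬, ∀ t ∈ 𝒬, s ≠ t → s ∩ t = C := by
  induction n generalizing 𝒮 with
  | zero =>
    obtain ⟨s, hs, t, ht, hst⟩ := Finset.one_lt_card.mp hcard
    exact absurd ((Finset.card_eq_zero.mp (Nat.le_zero.mp (hn s hs))).trans
      (Finset.card_eq_zero.mp (Nat.le_zero.mp (hn t ht))).symm) hst
  | succ n ih =>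
    obtain ⟨𝒟, h𝒟, hdis, hmax⟩ := exists_maximal_disjoint_subfamily 𝒮
    by_cases hk : k ≤ 𝒟.card
    · obtain ⟨𝒬, h𝒬, hc⟩ := Finset.exists_subset_card_eq hk
      exact ⟨𝒬, h𝒬.trans h𝒟, hc, ∅, fun s hs t ht hst =>
        Finset.disjoint_iff_inter_eq_empty.mp (hdis s (h𝒬 hs) t (h𝒬 ht) hst)⟩
    push Not at hk
    let W := 𝒟.biUnion id
    have hW : W.card ≤ k * (n + 1) :=
      (Finset.card_biUnion_le_card_mul 𝒟 id (n + 1) fun s hs => hn s (h𝒟 hs)).trans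
        (Nat.mul_le_mul_right _ hk.le)
    have hcover : 𝒮 ⊆ 𝒟 ∪ W.biUnion fun x => 𝒮.filter (x ∈ ·) := by
      intro s hs
      by_cases hsD : s ∈ 𝒟
      · exact Finset.mem_union_left _ hsD
      obtain ⟨t, ht, hst⟩ := hmax s hs hsD
      obtain ⟨x, hxs, hxt⟩ := Finset.not_disjoint_iff.mp hst
      exact Finset.mem_union_right _ (Finset.mem_biUnion.mpr
        ⟨x, Finset.mem_biUnion.mpr ⟨t, ht, hxt⟩, Finset.mem_filter.mpr ⟨hs, hxs⟩⟩)
    obtain ⟨x, -, hx⟩ : ∃ x ∈ W, sunflowerBound k n < (𝒮.filter (x ∈ ·)).card := by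
      -- The summand `k` of the bound pays for `𝒟`: an empty member would not meet `W`.
      by_contra! hcon
      have h1 := (Finset.card_le_card hcover).trans (Finset.card_union_le _ _)
      have h2 := Finset.card_biUnion_le_card_mul W (fun x => 𝒮.filter (x ∈ ·)) _ hcon
      have h3 := Nat.mul_le_mul_right (sunflowerBound k n) hW
      rw [sunflowerBound] at hcard
      omega
    have hinj : Set.InjOn (fun s : Finset γ => s.erase x) (𝒮.filter (x ∈ ·)) := by
      intro s hs t ht hst
      simp only [Finset.coe_filter, Set.mem_ofPred_eq] at hs ht
      rw [← Finset.insert_erase hs.2, ← Finset.insert_erase ht.2]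
      exact congrArg _ hst
    obtain ⟨𝒬, h𝒬, hc, C, hC⟩ := ih ((𝒮.filter (x ∈ ·)).image fun s => s.erase x)
      (by
        intro s hs
        obtain ⟨t, ht, rfl⟩ := Finset.mem_image.mp hs
        obtain ⟨ht, hxt⟩ := Finset.mem_filter.mp ht
        have := hn t ht
        rw [Finset.card_erase_of_mem hxt]
        omega)
      (by rwa [Finset.card_image_of_injOn hinj])
    have hx𝒬 : ∀ s ∈ 𝒬, x ∉ s ∧ insert x s ∈ 𝒮 := by
      intro s hs
      obtain ⟨t, ht, rfl⟩ := Finset.mem_image.mp (h𝒬 hs)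
      obtain ⟨ht, hxt⟩ := Finset.mem_filter.mp ht
      exact ⟨Finset.notMem_erase x t, by rwa [Finset.insert_erase hxt]⟩
    refine ⟨𝒬.image (insert x), ?_, ?_, insert x C, ?_⟩
    · intro s hs
      obtain ⟨t, ht, rfl⟩ := Finset.mem_image.mp hs
      exact (hx𝒬 t ht).2
    · rw [Finset.card_image_of_injOn, hc]
      intro s hs t ht hst
      rw [← Finset.erase_insert (hx𝒬 s hs).1, ← Finset.erase_insert (hx𝒬 t ht).1]
      exact congrArg (fun u => Finset.erase u x) hst
    · intro s hs t ht hst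
      obtain ⟨s, hs1, rfl⟩ := Finset.mem_image.mp hs
      obtain ⟨t, ht1, rfl⟩ := Finset.mem_image.mp ht
      rw [← Finset.insert_inter_distrib, hC s hs1 t ht1 fun h => hst (by rw [h])]

/-! ## Covers of tests by few partial functions -/

/-- A property of partial functions, given by total functions and finite sets on which their values
are considered, that is inherited by restrictions. -/
structure LocalPred (α : Type u) (β : Type v) where
  /-- the property of the restriction of a function to a finite set -/
  holds : Finset α → (α → β) → Prop
  mono : ∀ {V W F}, V ⊆ W → holds W F → holds V F
  congr : ∀ {V F G}, (∀ x ∈ V, F x = G x) → holds V F → holds V G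

/-- A test for partial functions. -/
structure FunTest (α : Type u) (β : Type v) where
  /-- the base of the test, on which the passing functions take few values -/
  base : Finset α
  /-- the support of the test, on which passing depends -/
  supp : Finset α
  /-- the functions that pass the test -/
  pass : Set (α → β)
  base_subset : base ⊆ supp
  pass_congr : ∀ {F G}, (∀ x ∈ supp, F x = G x) → F ∈ pass → G ∈ pass

/-- At most `e` functions that differ on the base pass the test. -/
def FunTest.CountLE {α : Type u} {β : Type v} (q : FunTest α β) (e : ℕ) : Prop :=
  ∀ 𝒟 : Finset (α → β), (∀ F ∈ 𝒟, F ∈ q.pass) →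
    (∀ F ∈ 𝒟, ∀ G ∈ 𝒟, (∀ x ∈ q.base, F x = G x) → F = G) → 𝒟.card ≤ e

/-- `T` consists of at most `p` functions with the property `P` on `V`, and each test within `V` is
passed by one of them. -/
structure IsCover {α : Type u} {β : Type v} (P : LocalPred α β) (𝓠 : Set (FunTest α β)) (p : ℕ)
    (V : Finset α) (T : Finset (α → β)) : Prop where
  card_le : T.card ≤ p
  holds : ∀ F ∈ T, P.holds V F
  pass : ∀ q ∈ 𝓠, q.supp ⊆ V → ∃ F ∈ T, F ∈ q.pass

section Cover

variable {α : Type u} {β : Type v}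

theorem IsCover.mono {P : LocalPred α β} {𝓠 : Set (FunTest α β)} {p : ℕ} {V W : Finset α}
    {T : Finset (α → β)} (h : IsCover P 𝓠 p W T) (hVW : V ⊆ W) : IsCover P 𝓠 p V T :=
  ⟨h.card_le, fun F hF => P.mono hVW (h.holds F hF), fun q hq hqV => h.pass q hq (hqV.trans hVW)⟩

theorem restrict_eq_iff {Z : Finset α} {F G : α → β} :
    Z.restrict F = Z.restrict G ↔ ∀ z ∈ Z, F z = G z := by
  simp [funext_iff]

theorem exists_separating (𝒢 : Finset (α → β)) (V : Finset α) :
    ∃ W ⊆ V, W.card ≤ 𝒢.card * 𝒢.card ∧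
      ∀ F ∈ 𝒢, ∀ G ∈ 𝒢, (∀ x ∈ W, F x = G x) → ∀ x ∈ V, F x = G x := by
  classical
  let s : (α → β) × (α → β) → Finset α := fun x =>
    if h : ∃ z ∈ V, x.1 z ≠ x.2 z then {h.choose} else ∅
  have hs : ∀ x, s x ⊆ V ∧ (s x).card ≤ 1 := by
    intro x
    by_cases h : ∃ z ∈ V, x.1 z ≠ x.2 z
    · simp only [s, dif_pos h, Finset.singleton_subset_iff, Finset.card_singleton, le_refl, and_true]
      exact h.choose_spec.1
    · simp [s, dif_neg h]
  refine ⟨(𝒢 ×ˢ 𝒢).biUnion s, Finset.biUnion_subset.mpr fun x _ => (hs x).1, ?_, ?_⟩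
  · refine (Finset.card_biUnion_le_card_mul _ _ 1 fun x _ => (hs x).2).trans ?_
    rw [Finset.card_product, mul_one]
  · intro F hF G hG hFG
    by_contra! hcon
    have hmem : hcon.choose ∈ s (F, G) := by simp [s, dif_pos hcon]
    exact hcon.choose_spec.2
      (hFG _ (Finset.mem_biUnion.mpr ⟨(F, G), Finset.mk_mem_product hF hG, hmem⟩))

theorem exists_eq_succ_of_monotone_of_le {c : ℕ → ℕ} (hc : Monotone c) {g : ℕ} (hg : ∀ i, c i ≤ g) :
    ∃ i ≤ g, c i = c (i + 1) := by
  by_contra! h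
  have : ∀ i ≤ g + 1, i ≤ c i := by
    intro i
    induction i with
    | zero => simp
    | succ i ih =>
      intro hi
      have h1 := ih (by omega)
      have h2 := h i (by omega)
      have h3 := hc (Nat.le_succ i)
      simp only [Nat.succ_eq_add_one] at h3
      omega
  have h1 := this (g + 1) le_rfl
  have h2 := hg (g + 1)
  omega

/-- The number of restrictions of members of `𝒢` to `V i` grows with `i` and is at most `𝒢.card`, so
it stagnates early; there, restricting from `V (i + 1)` to `V i` is injective. -/
theorem exists_stable_restriction {V : ℕ → Finset α} (hV : Monotone V) (𝒢 : Finset (α → β)) :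
    ∃ i ≤ 𝒢.card, ∀ F ∈ 𝒢, ∀ G ∈ 𝒢, (∀ x ∈ V i, F x = G x) → ∀ x ∈ V (i + 1), F x = G x := by
  classical
  have himage : ∀ {i j} (hij : i ≤ j), 𝒢.image (V i).restrict =
      (𝒢.image (V j).restrict).image (Finset.restrict₂ (π := fun _ => β) (hV hij)) := by
    intro i j hij
    rw [Finset.image_image, Finset.restrict₂_comp_restrict]
  obtain ⟨i, hi, hci⟩ := exists_eq_succ_of_monotone_of_le
    (c := fun i => (𝒢.image (V i).restrict).card)
    (fun i j hij => by simpa only [himage hij] using Finset.card_image_le)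
    (fun i => Finset.card_image_le)
  refine ⟨i, hi, fun F hF G hG hFG => ?_⟩
  simp only [himage (Nat.le_succ i)] at hci
  have hinj := Finset.card_image_iff.mp hci
  exact restrict_eq_iff.mp (hinj (Finset.mem_coe.mpr (Finset.mem_image_of_mem _ hF))
    (Finset.mem_coe.mpr (Finset.mem_image_of_mem _ hG)) (restrict_eq_iff.mpr hFG))

/-- The bound on the number of different covers of a long chain of sets. -/
abbrev coverBound (e p : ℕ) : ℕ := sunflowerBound (e + 2) (p + 1)

/-- The bound on the number of functions in the covers of a long chain of sets. -/
abbrev coverFunBound (e p : ℕ) : ℕ := (coverBound e p + 1) * (p + 1)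

/-- A sunflower among the covers restricted to `V (i + 1)` has a core of at most `p` functions,
which by `hsmall` misses a test `q` with base above `W`. Every cover in the sunflower passes `q` by
a function outside the core. Those of different petals differ on `W`, hence on the base: agreement
on `W` implies agreement on `V i` as `W` is separating, then on `V (i + 1)` by the choice of `i`,
and would put the function into the core. So too many functions pass `q`. -/
theorem not_exists_many_covers [Nonempty β] {P : LocalPred α β} {𝓠 : Set (FunTest α β)} {e p : ℕ}
    (he : ∀ q ∈ 𝓠, q.CountLE e) {V : ℕ → Finset α} (hV : Monotone V)
    (hsmall : ∀ i, ∀ W ⊆ V i, W.card ≤ coverFunBound e p * coverFunBound e p →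
      ∃ V' ⊆ V (i + 1), ∀ T, ¬ IsCover P {q ∈ 𝓠 | W ⊆ q.base} p V' T)
    {L : ℕ} (hL : coverFunBound e p + 1 ≤ L) (𝒯 : Finset (Finset (α → β)))
    (hcard : 𝒯.card = coverBound e p + 1)
    (hcover : ∀ T ∈ 𝒯, IsCover P 𝓠 (p + 1) (V L) T)
    (hinj : ∀ T ∈ 𝒯, ∀ T' ∈ 𝒯, (∀ F ∈ T, ∃ G ∈ T', ∀ x ∈ V 0, F x = G x) →
      (∀ G ∈ T', ∃ F ∈ T, ∀ x ∈ V 0, F x = G x) → T = T') : False := by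
  classical
  let 𝒢 := 𝒯.biUnion id
  have h𝒢 : 𝒢.card ≤ coverFunBound e p := by
    rw [coverFunBound, ← hcard]
    exact Finset.card_biUnion_le_card_mul 𝒯 id (p + 1) fun T hT => (hcover T hT).card_le
  have hmem𝒢 : ∀ T ∈ 𝒯, ∀ F ∈ T, F ∈ 𝒢 := fun T hT F hF => Finset.mem_biUnion.mpr ⟨T, hT, hF⟩
  obtain ⟨i, hi, hstab⟩ := exists_stable_restriction hV 𝒢
  obtain ⟨W, hWV, hWcard, hsep⟩ := exists_separating 𝒢 (V i)
  obtain ⟨V', hV', hno⟩ := hsmall i W hWV (hWcard.trans (Nat.mul_le_mul h𝒢 h𝒢))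
  have hiL : V (i + 1) ⊆ V L := hV (by omega)
  let ρ : Finset (α → β) → Finset (V (i + 1) → β) := fun T => T.image (V (i + 1)).restrict
  have hρ : Set.InjOn ρ 𝒯 := by
    have key : ∀ T T', ρ T ⊆ ρ T' → ∀ F ∈ T, ∃ G ∈ T', ∀ x ∈ V 0, F x = G x := by
      intro T T' h F hF
      obtain ⟨G, hG, hGF⟩ := Finset.mem_image.mp (h (Finset.mem_image_of_mem _ hF))
      exact ⟨G, hG, fun x hx => ((restrict_eq_iff.mp hGF) x (hV (Nat.zero_le _) hx)).symm⟩
    intro T hT T' hT' hTT'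
    refine hinj T hT T' hT' (key T T' hTT'.subset) fun G hG => ?_
    obtain ⟨F, hF, hFG⟩ := key T' T hTT'.superset G hG
    exact ⟨F, hF, fun x hx => (hFG x hx).symm⟩
  -- For the count at the end `e + 1` sets would do; `e + 2` ensures two different ones even if `e =
  -- 0`, which makes the core smaller than `p + 1`.
  obtain ⟨𝒮, h𝒮, h𝒮card, C, hC⟩ := exists_sunflower (e + 2) (p + 1) (𝒯.image ρ)
    (by
      intro s hs
      obtain ⟨T, hT, rfl⟩ := Finset.mem_image.mp hs
      exact Finset.card_image_le.trans (hcover T hT).card_le)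
    (by rw [Finset.card_image_of_injOn hρ, hcard]; exact Nat.lt_succ_self _)
  have hex : ∀ s ∈ 𝒮, ∃ T ∈ 𝒯, ρ T = s := fun s hs => Finset.mem_image.mp (h𝒮 hs)
  obtain ⟨s, hs, t, ht, hst⟩ := Finset.one_lt_card.mp (show 1 < 𝒮.card by omega)
  obtain ⟨T, hT, rfl⟩ := hex s hs
  have hCT : C ⊆ ρ T := by rw [← hC _ hs t ht hst]; exact Finset.inter_subset_left
  have hCcard : C.card ≤ p := by
    have hle : ∀ s ∈ 𝒮, s.card ≤ p + 1 := by
      intro s hs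
      obtain ⟨T, hT, rfl⟩ := hex s hs
      exact Finset.card_image_le.trans (hcover T hT).card_le
    by_contra! hcon
    have h1 : C = ρ T := Finset.eq_of_subset_of_card_le hCT ((hle _ hs).trans hcon)
    have h2 : C = t := Finset.eq_of_subset_of_card_le
      (by rw [← hC _ hs t ht hst]; exact Finset.inter_subset_right) ((hle _ ht).trans hcon)
    exact hst (h1.symm.trans h2)
  have hlift : ∀ c ∈ C, ∃ F ∈ T, (V (i + 1)).restrict F = c :=
    fun c hc => Finset.mem_image.mp (hCT hc)
  choose! lift hliftT hlift using hlift
  have hnoC := hno (C.image lift)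
  obtain ⟨q, hq, hqV', hqC⟩ : ∃ q ∈ {q ∈ 𝓠 | W ⊆ q.base}, q.supp ⊆ V' ∧
      ∀ c ∈ C, lift c ∉ q.pass := by
    by_contra! hcon
    refine hnoC ⟨Finset.card_image_le.trans hCcard, ?_, ?_⟩
    · intro F hF
      obtain ⟨c, hc, rfl⟩ := Finset.mem_image.mp hF
      exact P.mono (hV'.trans hiL) ((hcover T hT).holds _ (hliftT c hc))
    · intro q hq hqV'
      obtain ⟨c, hc, hcq⟩ := hcon q hq hqV'
      exact ⟨_, Finset.mem_image_of_mem _ hc, hcq⟩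
  have hpass : ∀ s ∈ 𝒮, ∃ F ∈ 𝒢, F ∈ q.pass ∧ (V (i + 1)).restrict F ∈ s := by
    intro s hs
    obtain ⟨T, hT, rfl⟩ := hex s hs
    obtain ⟨F, hF, hFq⟩ := (hcover T hT).pass q hq.1 ((hqV'.trans hV').trans hiL)
    exact ⟨F, hmem𝒢 T hT F hF, hFq, Finset.mem_image_of_mem _ hF⟩
  choose! pet hpet𝒢 hpetq hpets using hpass
  have hbase : ∀ s ∈ 𝒮, ∀ t ∈ 𝒮, (∀ x ∈ q.base, pet s x = pet t x) → s = t := by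
    intro s hs t ht hst
    by_contra hne
    have heq : (V (i + 1)).restrict (pet s) = (V (i + 1)).restrict (pet t) :=
      restrict_eq_iff.mpr (hstab _ (hpet𝒢 s hs) _ (hpet𝒢 t ht) (hsep _ (hpet𝒢 s hs) _ (hpet𝒢 t ht)
        fun x hx => hst x (hq.2 hx)))
    have hmem : (V (i + 1)).restrict (pet s) ∈ C := by
      rw [← hC s hs t ht hne]
      exact Finset.mem_inter.mpr ⟨hpets s hs, heq ▸ hpets t ht⟩
    refine hqC _ hmem (q.pass_congr (fun x hx => ?_) (hpetq s hs))
    exact (restrict_eq_iff.mp (hlift _ hmem) x (hV' (hqV' hx))).symm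
  have hfinal := he q hq.1 (𝒮.image pet)
    (by
      intro F hF
      obtain ⟨s, hs, rfl⟩ := Finset.mem_image.mp hF
      exact hpetq s hs)
    (by
      intro F hF G hG hFG
      obtain ⟨s, hs, rfl⟩ := Finset.mem_image.mp hF
      obtain ⟨t, ht, rfl⟩ := Finset.mem_image.mp hG
      rw [hbase s hs t ht hFG])
  rw [Finset.card_image_of_injOn, h𝒮card] at hfinal
  · omega
  · intro s hs t ht hst
    exact hbase s hs t ht fun x _ => congrFun hst x

/-- The functions that occur in covers. -/
def coverFuns (P : LocalPred α β) (𝓠 : Set (FunTest α β)) (p : ℕ) (V : Finset α) : Set (α → β) :=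
  {F | ∃ T, IsCover P 𝓠 p V T ∧ F ∈ T}

theorem coverFuns_anti {P : LocalPred α β} {𝓠 : Set (FunTest α β)} {p : ℕ} {V W : Finset α}
    (hVW : V ⊆ W) : coverFuns P 𝓠 p W ⊆ coverFuns P 𝓠 p V :=
  fun _ ⟨T, hT, hF⟩ => ⟨T, hT.mono hVW, hF⟩

/-- A cover contributes at most `p + 1` restrictions to `V 0`, so `coverFunBound e p` restrictions
would require at least `coverBound e p + 1` covers that differ on `V 0`. -/
theorem encard_coverFuns_lt [Nonempty β] {P : LocalPred α β} {𝓠 : Set (FunTest α β)} {e p : ℕ}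
    (he : ∀ q ∈ 𝓠, q.CountLE e) {V : ℕ → Finset α} (hV : Monotone V)
    (hsmall : ∀ i, ∀ W ⊆ V i, W.card ≤ coverFunBound e p * coverFunBound e p →
      ∃ V' ⊆ V (i + 1), ∀ T, ¬ IsCover P {q ∈ 𝓠 | W ⊆ q.base} p V' T)
    {L : ℕ} (hL : coverFunBound e p + 1 ≤ L) :
    ((V 0).restrict '' coverFuns P 𝓠 (p + 1) (V L)).encard < coverFunBound e p := by
  classical
  by_contra! hcon
  obtain ⟨𝒲s, h𝒲, hcard⟩ := Set.exists_subset_encard_eq hcon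
  obtain ⟨𝒲, rfl⟩ : ∃ 𝒲 : Finset (V 0 → β), 𝒲s = 𝒲 :=
    ⟨(Set.finite_of_encard_eq_coe hcard).toFinset, by simp⟩
  rw [Set.encard_coe_eq_coe_finsetCard, Nat.cast_inj] at hcard
  have hex : ∀ w ∈ 𝒲, ∃ T, IsCover P 𝓠 (p + 1) (V L) T ∧ w ∈ T.image (V 0).restrict := by
    intro w hw
    obtain ⟨F, ⟨T, hT, hFT⟩, rfl⟩ := h𝒲 hw
    exact ⟨T, hT, Finset.mem_image_of_mem _ hFT⟩
  choose! T hT hwT using hex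
  have himage : coverBound e p + 1 ≤ (𝒲.image fun w => (T w).image (V 0).restrict).card := by
    have h := Finset.card_le_mul_card_image (s := 𝒲)
      (f := fun w => (T w).image (V 0).restrict) (p + 1) (by
        intro b hb
        obtain ⟨w, hw, rfl⟩ := Finset.mem_image.mp hb
        refine le_trans (Finset.card_le_card (t := (T w).image (V 0).restrict) fun w' hw' => ?_)
          (Finset.card_image_le.trans (hT w hw).card_le)
        obtain ⟨hw', heq⟩ := Finset.mem_filter.mp hw'
        exact heq ▸ hwT w' hw')
    rw [hcard, coverFunBound, mul_comm] at h
    exact Nat.le_of_mul_le_mul_left h (Nat.succ_pos p)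
  obtain ⟨𝒞, h𝒞, h𝒞card⟩ := Finset.exists_subset_card_eq himage
  have hlift : ∀ b ∈ 𝒞, ∃ w ∈ 𝒲, (T w).image (V 0).restrict = b :=
    fun b hb => Finset.mem_image.mp (h𝒞 hb)
  choose! lift hlift𝒲 hlift using hlift
  refine not_exists_many_covers he hV hsmall hL (𝒞.image fun b => T (lift b)) ?_ ?_ ?_
  · rw [Finset.card_image_of_injOn, h𝒞card]
    intro b hb b' hb' hbb'
    rw [← hlift b hb, ← hlift b' hb']
    exact congrArg _ hbb'
  · intro S hS
    obtain ⟨b, hb, rfl⟩ := Finset.mem_image.mp hS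
    exact hT _ (hlift𝒲 b hb)
  · intro S hS S' hS' h h'
    obtain ⟨b, hb, rfl⟩ := Finset.mem_image.mp hS
    obtain ⟨b', hb', rfl⟩ := Finset.mem_image.mp hS'
    have : b = b' := by
      rw [← hlift b hb, ← hlift b' hb']
      apply Finset.Subset.antisymm
      · intro w hw
        obtain ⟨F, hF, rfl⟩ := Finset.mem_image.mp hw
        obtain ⟨G, hG, hFG⟩ := h F hF
        exact Finset.mem_image.mpr ⟨G, hG, (restrict_eq_iff.mpr hFG).symm⟩
      · intro w hw
        obtain ⟨G, hG, rfl⟩ := Finset.mem_image.mp hw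
        obtain ⟨F, hF, hFG⟩ := h' G hG
        exact Finset.mem_image.mpr ⟨F, hF, restrict_eq_iff.mpr hFG⟩
    rw [this]

theorem eq_of_encard_restrict_le {S : Set (α → β)} {Z W : Finset α} (hZW : Z ⊆ W) {n : ℕ}
    (hZ : n ≤ (Z.restrict '' S).encard) (hW : (W.restrict '' S).encard ≤ n)
    {F G : α → β} (hF : F ∈ S) (hG : G ∈ S) (hFG : ∀ x ∈ Z, F x = G x) : ∀ x ∈ W, F x = G x := by
  have himage : Z.restrict '' S = Finset.restrict₂ (π := fun _ => β) hZW '' (W.restrict '' S) := by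
    rw [← Set.image_comp, Finset.restrict₂_comp_restrict]
  have hfin : (W.restrict '' S).Finite := Set.finite_of_encard_le_coe hW
  have hinj := hfin.injOn_of_encard_image_eq
    (le_antisymm (Set.encard_image_le _ _) (hW.trans (himage ▸ hZ)))
  exact restrict_eq_iff.mp (hinj (Set.mem_image_of_mem _ hF) (Set.mem_image_of_mem _ hG)
    (restrict_eq_iff.mpr hFG))

/-- The cover functions have exactly `n` restrictions to `Z`, and over a suitable `v y` still at
most `n` to `insert y Z`. So the values on `Z` determine the value at `y`. Fixing the values of one
function `F₁` on `Z` therefore defines `h` pointwise, and a cover function over all `v y` with `y ∈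
Y` that agrees with `F₁` on `Z` must agree with `h` on `Y`. -/
theorem exists_holds_of_encard_coverFuns {P : LocalPred α β} {𝓠 : Set (FunTest α β)}
    {a p m t t' n : ℕ} {Z : Finset α} (ht : (a + 2) * t' + m ≤ t)
    (hle : ∀ V, Z ⊆ V → V.card ≤ t → n ≤ (Z.restrict '' coverFuns P 𝓠 p V).encard)
    (hge : ∀ W, Z ⊆ W → W.card ≤ Z.card + 1 → ∃ V, W ⊆ V ∧ V.card ≤ t' ∧
      (W.restrict '' coverFuns P 𝓠 p V).encard ≤ n)
    (hcover : ∀ V : Finset α, V.card ≤ t → ∃ T, IsCover P 𝓠 p V T)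
    {q : FunTest α β} (hq : q ∈ 𝓠) (hqm : q.supp.card ≤ m) :
    ∃ h : α → β, ∀ Y : Finset α, Y.card ≤ a → P.holds Y h := by
  classical
  -- The set `V₁` below costs `t' + m`, a single `v y` costs `t'`, and all those for `Y` cost `a *
  -- t'`; the factor `a + 2` allows both enlargements of `V₁`, also for `a = 0`.
  have ht2 : 2 * t' + m ≤ t := by nlinarith
  obtain ⟨V₀, hZV₀, hV₀card, hV₀⟩ := hge Z subset_rfl (Nat.le_succ _)
  have hge' : ∀ y, ∃ V, insert y Z ⊆ V ∧ V.card ≤ t' ∧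
      ((insert y Z).restrict '' coverFuns P 𝓠 p V).encard ≤ n :=
    fun y => hge _ (Finset.subset_insert _ _) (Finset.card_insert_le _ _)
  choose v hZv hvcard hv using hge'
  let V₁ := V₀ ∪ q.supp
  have hV₁card : V₁.card ≤ t' + m :=
    (Finset.card_union_le _ _).trans (Nat.add_le_add hV₀card hqm)
  -- The role of the test `q` is to make this cover non-empty.
  obtain ⟨T₁, hT₁⟩ := hcover V₁ (by omega)
  obtain ⟨F₁, hF₁T, -⟩ := hT₁.pass q hq Finset.subset_union_right
  have hF₁ : F₁ ∈ coverFuns P 𝓠 p V₀ :=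
    coverFuns_anti Finset.subset_union_left ⟨T₁, hT₁, hF₁T⟩
  have hex : ∀ V, V₁ ⊆ V → V.card ≤ t → ∃ F ∈ coverFuns P 𝓠 p V, ∀ z ∈ Z, F z = F₁ z := by
    intro V hV hVcard
    have hV₀V : V₀ ⊆ V := Finset.subset_union_left.trans hV
    have heq : Z.restrict '' coverFuns P 𝓠 p V = Z.restrict '' coverFuns P 𝓠 p V₀ :=
      Set.Finite.eq_of_subset_of_encard_le' (Set.finite_of_encard_le_coe hV₀)
        (Set.image_mono (coverFuns_anti hV₀V))
        (hV₀.trans (hle V (hZV₀.trans hV₀V) hVcard))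
    obtain ⟨F, hF, hFF₁⟩ := heq.symm ▸ Set.mem_image_of_mem Z.restrict hF₁
    exact ⟨F, hF, restrict_eq_iff.mp hFF₁⟩
  have huniq : ∀ y, ∀ F ∈ coverFuns P 𝓠 p (v y), ∀ G ∈ coverFuns P 𝓠 p (v y),
      (∀ z ∈ Z, F z = G z) → F y = G y := fun y F hF G hG hFG =>
    eq_of_encard_restrict_le (Finset.subset_insert y Z)
      (hle _ ((Finset.subset_insert y Z).trans (hZv y)) (by have := hvcard y; omega)) (hv y)
      hF hG hFG y (Finset.mem_insert_self _ _)
  have hext : ∀ y, ∃ F ∈ coverFuns P 𝓠 p (V₁ ∪ v y), ∀ z ∈ Z, F z = F₁ z := fun y =>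
    hex _ Finset.subset_union_left
      ((Finset.card_union_le _ _).trans (by have := hvcard y; omega))
  choose E hE hEF₁ using hext
  refine ⟨fun y => E y y, fun Y hY => ?_⟩
  obtain ⟨F, hF, hFF₁⟩ := hex (V₁ ∪ Y.biUnion v) Finset.subset_union_left (by
    have h1 := Finset.card_union_le V₁ (Y.biUnion v)
    have h2 := Finset.card_biUnion_le_card_mul Y v t' fun y _ => hvcard y
    have h3 := Nat.mul_le_mul_right t' hY
    nlinarith)
  have hFY : ∀ y ∈ Y, F y = E y y := by
    intro y hy
    refine huniq y F (coverFuns_anti ?_ hF) (E y)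
      (coverFuns_anti Finset.subset_union_right (hE y))
      fun z hz => (hFF₁ z hz).trans (hEF₁ y z hz).symm
    exact (Finset.subset_biUnion_of_mem v hy).trans Finset.subset_union_right
  obtain ⟨T, hT, hFT⟩ := hF
  refine P.congr hFY (P.mono (fun y hy => ?_) (hT.holds F hFT))
  exact Finset.mem_union_right _
    (Finset.mem_biUnion.mpr ⟨y, hy, hZv y (Finset.mem_insert_self _ _)⟩)

/-- Each step adds `v W` for all small subsets `W`; a set of size `s` has at most `2 ^ s` of them.
-/
theorem exists_chain (w K : ℕ) (v : Finset α → Finset α)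
    (hv : ∀ W : Finset α, W.card ≤ w → (v W).card ≤ K) (Z : Finset α) :
    ∃ V : ℕ → Finset α, V 0 = Z ∧ Monotone V ∧ (∀ i, ∀ W ⊆ V i, W.card ≤ w → v W ⊆ V (i + 1)) ∧
      ∀ i, (V i).card ≤ (fun s => s + 2 ^ s * K)^[i] Z.card := by
  classical
  let f : Finset α → Finset α := fun V => V ∪ (V.powerset.filter (·.card ≤ w)).biUnion v
  refine ⟨fun i => f^[i] Z, rfl, ?_, ?_, ?_⟩
  · refine monotone_nat_of_le_succ fun i => ?_
    rw [Function.iterate_succ_apply']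
    exact Finset.subset_union_left
  · intro i W hW hWw
    simp only [Function.iterate_succ_apply']
    exact (Finset.subset_biUnion_of_mem v
      (Finset.mem_filter.mpr ⟨Finset.mem_powerset.mpr hW, hWw⟩)).trans Finset.subset_union_right
  · intro i
    induction i with
    | zero => exact le_rfl
    | succ i ih =>
      simp only [Function.iterate_succ_apply']
      set V := f^[i] Z
      refine (Finset.card_union_le _ _).trans (Nat.add_le_add ih ?_)
      refine (Finset.card_biUnion_le_card_mul _ _ K
        fun W hW => hv W (Finset.mem_filter.mp hW).2).trans (Nat.mul_le_mul_right _ ?_)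
      refine (Finset.card_filter_le _ _).trans ?_
      rw [Finset.card_powerset]
      exact Nat.pow_le_pow_right (by norm_num) ih

theorem iterate_add_pow_mono (K i : ℕ) : Monotone (fun s => s + 2 ^ s * K)^[i] := by
  refine Monotone.iterate (fun s s' h => ?_) i
  exact Nat.add_le_add h (Nat.mul_le_mul_right _ (Nat.pow_le_pow_right (by norm_num) h))

/-- If the tests can be passed locally by few functions, then there is a globally defined function
with the property `P`, or there are no tests above some small set. -/
theorem exists_holds_or_no_tests (a e p : ℕ) : ∃ z : ℕ, ∀ m : ℕ, ∃ K : ℕ,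
    ∀ (α : Type u) (β : Type v) [Nonempty β] (P : LocalPred α β) (𝓠 : Set (FunTest α β)),
      (∀ q ∈ 𝓠, q.CountLE e) → (∀ q ∈ 𝓠, q.supp.card ≤ m) →
      (∀ V : Finset α, V.card ≤ K → ∃ T, IsCover P 𝓠 p V T) →
      (∃ h : α → β, ∀ Y : Finset α, Y.card ≤ a → P.holds Y h) ∨
        ∃ Z : Finset α, Z.card ≤ z ∧ ∀ q ∈ 𝓠, ¬ Z ⊆ q.base := by
  classical
  induction p with
  | zero =>
    -- An empty cover passes no test, and `K = m` admits the support of every test. So there are no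
    -- tests at all.
    refine ⟨0, fun m => ⟨m, fun α β _ P 𝓠 _ hm hcover => Or.inr ⟨∅, le_rfl, fun q hq _ => ?_⟩⟩⟩
    obtain ⟨T, hT⟩ := hcover q.supp (hm q hq)
    obtain ⟨F, hF, -⟩ := hT.pass q hq subset_rfl
    exact absurd hT.card_le (by have := Finset.card_pos.mpr ⟨F, hF⟩; omega)
  | succ p ih =>
    obtain ⟨z, ih⟩ := ih
    let N := coverFunBound e p
    -- `N * N` bounds a separating set `W`, and `z` the set that the induction hypothesis yields for
    -- the tests above `W`. This does not depend on `m`.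
    refine ⟨N * N + z, fun m => ?_⟩
    obtain ⟨K, ih⟩ := ih m
    -- `t 0` bounds the last set of a chain of `N + 1` closure steps starting with at most `N`
    -- elements; the recursion is the size condition of `exists_holds_of_encard_coverFuns`.
    let t : ℕ → ℕ := fun s => Nat.rec ((fun s => s + 2 ^ s * K)^[N + 1] N)
      (fun _ t' => (a + 2) * t' + m) s
    refine ⟨t N, fun α β _ P 𝓠 he hm hcover => ?_⟩
    by_contra! hcon
    obtain ⟨hnohom, htests⟩ := hcon
    have hV : ∀ W : Finset α, W.card ≤ N * N →
        ∃ V : Finset α, V.card ≤ K ∧ ∀ T, ¬ IsCover P {q ∈ 𝓠 | W ⊆ q.base} p V T := by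
      intro W hW
      by_contra! hcon
      rcases ih α β P {q ∈ 𝓠 | W ⊆ q.base} (fun q hq => he q hq.1) (fun q hq => hm q hq.1) hcon
        with ⟨h, hh⟩ | ⟨Z, hZ, hno⟩
      · obtain ⟨Y, hY, hhY⟩ := hnohom h
        exact hhY (hh Y hY)
      · obtain ⟨q, hq, hqWZ⟩ := htests (W ∪ Z) ((Finset.card_union_le _ _).trans (by omega))
        exact hno q ⟨hq, Finset.subset_union_left.trans hqWZ⟩
          (Finset.subset_union_right.trans hqWZ)
    choose! v hvK hv using hV
    have ht_anti : ∀ s, t s ≤ t (s + 1) := by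
      intro s
      change t s ≤ (a + 2) * t s + m
      nlinarith
    have ht_mono : Monotone t := monotone_nat_of_le_succ ht_anti
    -- `Q n` says that over all moderately large sets there remain `n` restrictions to a fixed set
    -- of at most `n` elements. It holds for `0` and fails for `N`; at the last `n` before a
    -- failure, adding one point to `Z` cannot force a further restriction.
    let Q : ℕ → Prop := fun n => ∃ Z : Finset α, Z.card ≤ n ∧
      ∀ V, Z ⊆ V → V.card ≤ t (N - n) → n ≤ (Z.restrict '' coverFuns P 𝓠 (p + 1) V).encard
    have hQ0 : Q 0 := ⟨∅, le_rfl, fun V _ _ => by simp⟩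
    have hQN : ¬ Q N := by
      rintro ⟨Z, hZ, hle⟩
      obtain ⟨V, rfl, hVmono, hVv, hVcard⟩ := exists_chain (N * N) K v hvK Z
      refine (hle (V (N + 1)) (hVmono (Nat.zero_le _)) ?_).not_gt
        (encard_coverFuns_lt he hVmono (fun i W hW hWc => ⟨v W, hVv i W hW hWc, hv W hWc⟩) le_rfl)
      rw [Nat.sub_self]
      exact (hVcard _).trans (iterate_add_pow_mono K _ hZ)
    obtain ⟨n, hnN, hQn, hQn'⟩ : ∃ n, n < N ∧ Q n ∧ ¬ Q (n + 1) := by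
      by_contra! hcon
      have : ∀ n ≤ N, Q n := by
        intro n
        induction n with
        | zero => exact fun _ => hQ0
        | succ n ihn => exact fun hn => hcon n (by omega) (ihn (by omega))
      exact hQN (this N le_rfl)
    obtain ⟨Z, hZ, hle⟩ := hQn
    obtain ⟨q, hq, -⟩ := htests ∅ (by simp)
    obtain ⟨h, hh⟩ := exists_holds_of_encard_coverFuns (P := P) (𝓠 := 𝓠) (a := a) (p := p + 1)
      (m := m) (t := t (N - n)) (t' := t (N - (n + 1))) (n := n) (Z := Z)
      (by
        rw [show N - n = (N - (n + 1)) + 1 by omega])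
      hle
      (by
        intro W hZW hWcard
        by_contra! hcon
        refine hQn' ⟨W, by omega, fun V hWV hVcard => ?_⟩
        rw [Nat.cast_add, Nat.cast_one]
        exact Order.add_one_le_of_lt (hcon V hWV hVcard))
      (fun V hVcard => hcover V (hVcard.trans (ht_mono (Nat.sub_le _ _)))) hq (hm q hq)
    obtain ⟨Y, hY, hhY⟩ := hnohom h
    exact hhY (hh Y hY)

end Cover

/-! ## The combinatorial gap theorem -/

section Gap

variable {S : Sig} {X : Str.{v} S} {D : Str.{u} S}

theorem IsPartialHom.restrict {K L : Finset X.Elem} (h : L ⊆ K) {f : Assignment X D K}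
    (hf : IsPartialHom X D f) : IsPartialHom X D (Assignment.restrict h f) :=
  fun R a ha hL => hf R a ha fun i => h (hL i)

/-- The function `F` extends the assignment `f`. -/
def Assignment.IsExtendedBy {K : Finset X.Elem} (f : Assignment X D K)
    (F : X.Elem → Option D.Elem) : Prop :=
  ∀ x, F x.1 = some ⟨x.1.1, f x⟩

theorem Assignment.IsExtendedBy.restrict {K L : Finset X.Elem} (h : L ⊆ K)
    {f : Assignment X D K} {F : X.Elem → Option D.Elem} (hf : f.IsExtendedBy F) :
    (Assignment.restrict h f).IsExtendedBy F :=
  fun x => hf ⟨x.1, h x.2⟩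

/-- Elements of `D.Elem` carry their types, so one codomain serves all types; `none` fills the
places outside `K` and keeps the codomain non-empty even if `D` is empty. -/
theorem Assignment.exists_isExtendedBy {K : Finset X.Elem} (f : Assignment X D K) :
    ∃ F, f.IsExtendedBy F := by
  classical
  exact ⟨fun x => if h : x ∈ K then some ⟨x.1, f ⟨x, h⟩⟩ else none, fun x => dif_pos x.2⟩

variable (X D) in
/-- The local property of being a partial homomorphism. -/
def partialHomPred : LocalPred X.Elem (Option D.Elem) where
  holds V F := ∃ f : Assignment X D V, IsPartialHom X D f ∧ f.IsExtendedBy F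
  mono := fun h ⟨_, hf, hF⟩ => ⟨_, hf.restrict h, hF.restrict h⟩
  congr := fun h ⟨f, hf, hF⟩ => ⟨f, hf, fun x => (h x.1 x.2).symm.trans (hF x)⟩

/-- Singletons show that the values have the right types, and the sets of entries of related tuples
show that relations are preserved. -/
theorem homTo_of_partialHomPred {a : ℕ} (ha : 1 ≤ a) (har : ∀ R, (S.ar R).len ≤ a)
    {F : X.Elem → Option D.Elem}
    (hF : ∀ Y : Finset X.Elem, Y.card ≤ a → (partialHomPred X D).holds Y F) : HomTo X D := by
  classical
  have hval : ∀ x : X.Elem, ∃ y : D.dom x.1, F x = some ⟨x.1, y⟩ := by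
    intro x
    obtain ⟨f, -, hf⟩ := hF {x} (by simpa using ha)
    exact ⟨_, hf ⟨x, Finset.mem_singleton_self x⟩⟩
  choose val hval using hval
  refine ⟨⟨fun t x => val ⟨t, x⟩, fun R b hb => ?_⟩⟩
  let Y : Finset X.Elem := Finset.univ.image fun i => ⟨(S.ar R).typ i, b i⟩
  obtain ⟨f, hf, hfF⟩ := hF Y (Finset.card_image_le.trans (by simpa using har R))
  have hY : ∀ i, (⟨(S.ar R).typ i, b i⟩ : X.Elem) ∈ Y :=
    fun i => Finset.mem_image_of_mem _ (Finset.mem_univ i)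
  convert hf R b hb hY using 1
  funext i
  have h := (hval _).symm.trans (hfF ⟨_, hY i⟩)
  simpa [Tuple.map] using h

variable {r : ℕ} {k : Fin (r + 2) → ℕ}
  (I : ∀ (i : Fin (r + 2)) (U : SmallSet X (k i)), Set (Assignment X D U.1))

/-- The test given by a chain of sets: a function passes if it extends one of the given assignments
of a member of the chain. -/
def chainTest (U : ∀ i : Fin (r + 1), SmallSet X (k i.succ))
    (hU : ∀ i j, i ≤ j → (U j).1 ⊆ (U i).1) : FunTest X.Elem (Option D.Elem) where
  base := (U (Fin.last r)).1
  supp := (U 0).1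
  pass := {F | ∃ j : Fin (r + 1), ∃ f ∈ I j.succ (U j), f.IsExtendedBy F}
  base_subset := hU _ _ (Fin.zero_le _)
  pass_congr := fun h ⟨j, f, hf, hF⟩ =>
    ⟨j, f, hf, fun x => (h _ (hU 0 j (Fin.zero_le _) x.2)).symm.trans (hF x)⟩

/-- The tests given by chains of sets that do not witness the consistency of the schemes other than
the first one. -/
def chainTests : Set (FunTest X.Elem (Option D.Elem)) :=
  {q | ∃ (U : ∀ i : Fin (r + 1), SmallSet X (k i.succ)) (hU : ∀ i j, i ≤ j → (U j).1 ⊆ (U i).1),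
    (∀ (i j : Fin (r + 1)) (hij : i < j), ∀ f ∈ I i.succ (U i),
      Assignment.restrict (hU i j hij.le) f ∉ I j.succ (U j)) ∧ q = chainTest I U hU}

/-- A passing function extends one of at most `(r + 1) * d` assignments, and each of these
determines it on the base, the smallest set of the chain. -/
theorem countLE_of_mem_chainTests {d : ℕ} (hI : ∀ i U, (I i U).encard ≤ d) :
    ∀ q ∈ chainTests I, q.CountLE ((r + 1) * d) := by
  classical
  rintro _ ⟨U, hU, -, rfl⟩ 𝒟 hpass hinj
  have hfin : ∀ j : Fin (r + 1), (I j.succ (U j)).Finite :=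
    fun j => Set.finite_of_encard_le_coe (hI _ _)
  let 𝒜 : Finset (Σ j : Fin (r + 1), Assignment X D (U j).1) :=
    Finset.univ.sigma fun j => (hfin j).toFinset
  have h𝒜 : 𝒜.card ≤ (r + 1) * d := by
    rw [Finset.card_sigma]
    refine (Finset.sum_le_card_nsmul _ _ d fun j _ => ?_).trans (by simp)
    have h := hI _ (U j)
    rw [← (hfin j).coe_toFinset, Set.encard_coe_eq_coe_finsetCard] at h
    exact_mod_cast h
  refine le_trans ?_ h𝒜
  have hex : ∀ F ∈ 𝒟, ∃ s ∈ 𝒜, s.2.IsExtendedBy F := by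
    intro F hF
    obtain ⟨j, f, hf, hfF⟩ := hpass F hF
    exact ⟨⟨j, f⟩, Finset.mem_sigma.mpr ⟨Finset.mem_univ _, (hfin j).mem_toFinset.mpr hf⟩, hfF⟩
  by_contra! hlt
  have hex' : ∀ F : 𝒟, ∃ s : 𝒜, s.1.2.IsExtendedBy F.1 := fun F => by
    obtain ⟨s, hs, hsF⟩ := hex F.1 F.2
    exact ⟨⟨s, hs⟩, hsF⟩
  choose s hs using hex'
  obtain ⟨F, G, hFG, hsFG⟩ := Fintype.exists_ne_map_eq_of_card_lt s (by simpa using hlt)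
  refine hFG (Subtype.ext (hinj F.1 F.2 G.1 G.2 fun x hx => ?_))
  have hx' : x ∈ (U (s F).1.1).1 := hU _ _ (Fin.le_last _) hx
  have h1 := hs F
  have h2 := hs G
  rw [← hsFG] at h2
  exact (h1 ⟨x, hx'⟩).trans (h2 ⟨x, hx'⟩).symm

/-- Put `V` in front of the chain of a test. The pair `i < j` given by consistency must have `i =
0`, as the later schemes are inconsistent on the chain; so some `f ∈ I 0 V` restricts to a given
assignment and passes. -/
theorem exists_isCover_chainTests {d : ℕ}
    (hI : ∀ i U, (I i U).encard ≤ d ∧ ∀ f ∈ I i U, IsPartialHom X D f)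
    (hcons : ∀ (U : ∀ i, SmallSet X (k i)) (hU : ∀ i j, i ≤ j → (U j).1 ⊆ (U i).1),
      ∃ (i j : Fin (r + 2)) (hij : i < j), ∃ f ∈ I i (U i),
        Assignment.restrict (hU i j hij.le) f ∈ I j (U j))
    (V : Finset X.Elem) (hV : V.card ≤ k 0) :
    ∃ T, IsCover (partialHomPred X D) (chainTests I) d V T := by
  classical
  let V' : SmallSet X (k 0) := ⟨V, hV⟩
  have hfin : (I 0 V').Finite := Set.finite_of_encard_le_coe (hI 0 V').1
  choose ext hext using fun f : Assignment X D V => f.exists_isExtendedBy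
  refine ⟨hfin.toFinset.image ext, ?_, ?_, ?_⟩
  · refine Finset.card_image_le.trans ?_
    have h := (hI 0 V').1
    rw [← hfin.coe_toFinset, Set.encard_coe_eq_coe_finsetCard] at h
    exact_mod_cast h
  · intro F hF
    obtain ⟨f, hf, rfl⟩ := Finset.mem_image.mp hF
    exact ⟨f, (hI 0 V').2 f (hfin.mem_toFinset.mp hf), hext f⟩
  · rintro _ ⟨U, hU, hbad, rfl⟩ hUV
    have hUV : (U 0).1 ⊆ V := hUV
    have hcU : ∀ i j : Fin (r + 2), i ≤ j →
        ((Fin.cons V' U : ∀ i, SmallSet X (k i)) j).1 ⊆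
          ((Fin.cons V' U : ∀ i, SmallSet X (k i)) i).1 := by
      intro i j hij
      induction i using Fin.cases with
      | zero =>
        induction j using Fin.cases with
        | zero => exact subset_rfl
        | succ j => exact (hU 0 j (Fin.zero_le _)).trans hUV
      | succ i =>
        induction j using Fin.cases with
        | zero => exact absurd hij (by simp)
        | succ j => exact hU i j (Fin.succ_le_succ_iff.mp hij)
    obtain ⟨i, j, hij, f, hf, hfj⟩ := hcons (Fin.cons V' U) hcU
    induction j using Fin.cases with
    | zero => exact absurd hij (by simp)
    | succ j =>
      induction i using Fin.cases with
      | zero =>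
        exact ⟨ext f, Finset.mem_image_of_mem _ (hfin.mem_toFinset.mpr hf), j, _, hfj,
          (hext f).restrict _⟩
      | succ i => exact absurd hfj (hbad i j (Fin.succ_lt_succ_iff.mp hij) f hf)

/-- The new scheme at `U` consists of the restrictions of `I i.succ (U ∪ Z)`. An inconsistent chain
for it would give a test whose base contains `Z`. -/
theorem allowsConsistentSchemes_of_no_chainTests {d z : ℕ}
    (hI : ∀ i U, (I i U).encard ≤ d ∧ ∀ f ∈ I i U, IsPartialHom X D f)
    {Z : Finset X.Elem} (hZ : Z.card ≤ z) (hno : ∀ q ∈ chainTests I, ¬ Z ⊆ q.base)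
    {k' : Fin (r + 1) → ℕ} (hk : ∀ i, k' i + z ≤ k i.succ) :
    AllowsConsistentSchemes X D k' d := by
  classical
  let E : ∀ i, SmallSet X (k' i) → SmallSet X (k i.succ) := fun i U =>
    ⟨U.1 ∪ Z, (Finset.card_union_le _ _).trans ((Nat.add_le_add U.2 hZ).trans (hk i))⟩
  refine ⟨fun i U => Assignment.restrict (K := (E i U).1) Finset.subset_union_left ''
    I i.succ (E i U), fun i U => ⟨?_, ?_⟩, fun U hU => ?_⟩
  · exact (Set.encard_image_le _ _).trans (hI _ _).1
  · rintro _ ⟨f, hf, rfl⟩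
    exact ((hI _ _).2 f hf).restrict _
  · have hEU : ∀ i j, i ≤ j → (E j (U j)).1 ⊆ (E i (U i)).1 :=
      fun i j hij => Finset.union_subset_union_left (hU i j hij)
    by_contra! hcon
    refine hno _ ⟨fun i => E i (U i), hEU, fun i j hij f hf hfj => ?_, rfl⟩
      Finset.subset_union_right
    exact hcon i j hij _ ⟨f, hf, rfl⟩ ⟨_, hfj, rfl⟩

end Gap

/-- The combinatorial gap theorem. -/
theorem exists_isGapSequence {S : Sig} (D : Str.{u} S) (d r : ℕ) :
    ∃ k : Fin (r + 1) → ℕ, IsGapSequence D d k ∧ 1 ≤ k 0 := by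
  suffices h : ∃ k : Fin (r + 1) → ℕ, Antitone k ∧ 1 ≤ k 0 ∧
      ∀ X : Str.{0} S, AllowsConsistentSchemes X D k d → HomTo X D by
    obtain ⟨k, hk, hk0, h⟩ := h
    exact ⟨k, ⟨hk, fun X _ => h X⟩, hk0⟩
  obtain ⟨a, ha, har⟩ : ∃ a : ℕ, 1 ≤ a ∧ ∀ R, (S.ar R).len ≤ a := by
    have := S.finite_sym
    obtain ⟨a, ha⟩ := (Set.finite_range fun R => (S.ar R).len).bddAbove
    exact ⟨a + 1, by omega, fun R => (ha (Set.mem_range_self R)).trans (Nat.le_succ a)⟩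
  induction r with
  | zero =>
    -- With a single scheme there are no `i < j`, so no instance allows a consistent sequence; the
    -- value `1` serves `1 ≤ k 0`.
    refine ⟨fun _ => 1, antitone_const, le_rfl, fun X ⟨I, _, hI⟩ => ?_⟩
    obtain ⟨i, j, hij, -⟩ := hI (fun _ => ⟨∅, by simp⟩) (fun _ _ _ => subset_rfl)
    omega
  | succ r ih =>
    obtain ⟨k', hk', hk'0, ih⟩ := ih
    obtain ⟨z, hz⟩ := exists_holds_or_no_tests.{0, u} a ((r + 1) * d) d
    -- The new `k 1` is `k' 0 + z` and bounds the supports of the tests; hence `z` has to be fixed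
    -- before this bound, and `K` after it.
    obtain ⟨K, hK⟩ := hz (k' 0 + z)
    have hcons : Antitone (Fin.cons (max K (k' 0 + z)) fun i => k' i + z : Fin (r + 2) → ℕ) := by
      rw [Fin.antitone_iff_succ_le]
      intro i
      induction i using Fin.cases with
      | zero => simp
      | succ i =>
        rw [← Fin.succ_castSucc, Fin.cons_succ, Fin.cons_succ]
        exact Nat.add_le_add_right (hk' i.castSucc_le_succ) z
    refine ⟨Fin.cons (max K (k' 0 + z)) fun i => k' i + z, hcons, ?_, fun X ⟨I, hI, hIc⟩ => ?_⟩
    · rw [Fin.cons_zero]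
      omega
    rcases hK X.Elem (Option D.Elem) (partialHomPred X D) (chainTests I)
      (countLE_of_mem_chainTests I fun i U => (hI i U).1)
      (by
        rintro _ ⟨U, hU, -, rfl⟩
        exact (U 0).2)
      (fun V hV => exists_isCover_chainTests I hI hIc V (hV.trans (le_max_left _ _)))
      with ⟨F, hF⟩ | ⟨Z, hZ, hno⟩
    · exact homTo_of_partialHomPred ha har hF
    · exact ih X (allowsConsistentSchemes_of_no_chainTests I hI hZ hno fun i => le_rfl)

/-! ## The consistency reduction is a reduction -/

theorem Hom.ext_map {S : Sig} {A : Str.{u} S} {B : Str.{v} S} {f g : Hom A B}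
    (h : ∀ t x, f.map t x = g.map t x) : f = g := by
  obtain ⟨f, hf⟩ := f
  obtain ⟨g, hg⟩ := g
  obtain rfl : f = g := funext fun t => funext fun x => h t x
  rfl

/-- The restriction of a homomorphism to a finite set. -/
def Hom.assignment {S : Sig} {X : Str.{u} S} {A : Str.{v} S} (h : Hom X A) (K : Finset X.Elem) :
    Assignment X A K :=
  fun x => h.map x.1.1 x.1.2

theorem Hom.assignment_mem_kConsistency {S : Sig} {X : Str.{u} S} {A : Str.{v} S} (h : Hom X A)
    (k : ℕ) (K : SmallSet X k) : h.assignment K.1 ∈ kConsistency k X A K := by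
  refine ⟨fun K => {h.assignment K.1}, ⟨?_, fun L K hLK => ⟨?_, ?_⟩⟩, rfl⟩
  · rintro K _ rfl R a ha _
    exact h.map_rel R a ha
  · rintro _ rfl
    exact ⟨_, rfl, rfl⟩
  · rintro _ rfl
    rfl

/-- A homomorphism restricts to an element of every `𝓕 K`; evaluation at these elements respects the
identifications. -/
theorem HomTo.consReduction {S S' : Sig} {A : Str.{0} S} (B : Str.{0} S') {X : Str.{0} S} (k : ℕ)
    (h : HomTo X A) : HomTo (consReduction k A B X) B := by
  obtain ⟨h⟩ := h
  refine ⟨⟨fun t => Quot.lift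
    (fun y => y.2 ⟨h.assignment y.1.1, h.assignment_mem_kConsistency k y.1⟩) ?_, ?_⟩⟩
  · rintro _ _ ⟨L, K, hLK, b⟩
    rfl
  · rintro R _ ⟨K, b, hb, rfl⟩
    exact hb ⟨h.assignment K.1, h.assignment_mem_kConsistency k K⟩

section Soundness

variable {S S' : Sig} {X : Str.{0} S} {A : Str.{0} S} {B : Str.{0} S'}

theorem finite_kConsistency (hA : A.IsFinite) {k : ℕ} (K : SmallSet X k) :
    Finite (kConsistency k X A K) := by
  have : ∀ x : {x : X.Elem // x ∈ K.1}, Finite (A.dom x.1.1) := fun x => hA x.1.1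
  infer_instance

theorem kConsistency.restrict_surjective {k : ℕ} {L K : SmallSet X k} (hLK : L.1 ⊆ K.1) :
    Function.Surjective (kConsistency.restrict (A := A) hLK) := by
  rintro ⟨f, hf⟩
  obtain ⟨g, hg, rfl⟩ := ((isConsistentSystem_kConsistency k X A).2 L K hLK).1 f hf
  exact ⟨⟨g, hg⟩, rfl⟩

/-- The homomorphism from a power of `B` obtained from a homomorphism from the output of the
consistency reduction. -/
def Hom.consPow {D : Str.{v} S'} {k : ℕ} (g : Hom (consReduction k A B X) D) (K : SmallSet X k) :
    Hom (B.pow (kConsistency k X A K)) D where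
  map t b := g.map t (Quot.mk _ ⟨K, b⟩)
  map_rel R b hb := g.map_rel R (fun i => Quot.mk _ ⟨K, b i⟩) ⟨K, b, hb, rfl⟩

theorem Hom.consPow_restrict {D : Str.{v} S'} {k : ℕ} (g : Hom (consReduction k A B X) D)
    {L K : SmallSet X k} (hLK : L.1 ⊆ K.1) (t : S'.Ty) (b : kConsistency k X A L → B.dom t) :
    (g.consPow K).map t (fun f => b (kConsistency.restrict hLK f)) = (g.consPow L).map t b :=
  congrArg (g.map t) (Quot.sound (ConsIdent.glue L K hLK b))

end Soundness

section

variable {S S' : Sig} {T : PromiseTemplate.{u} S} {T' : PromiseTemplate.{v} S'}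

/-- The element of `ω(Pol(B, B'))` given by the set `𝓕 K` and a homomorphism from the output of the
consistency reduction. -/
def consOmega {k : ℕ} {X : Str.{0} S} (g : Hom (consReduction k T.yes T'.yes X) T'.no)
    (K : SmallSet X k) [Finite (kConsistency k X T.yes K)] :
    (omega (Pol T')).obj (kConsistency k X T.yes K) :=
  ⟨Set.univ, (Pol T').map (fun x => ⟨x, Set.mem_univ x⟩) (g.consPow K)⟩

/-- The second components agree by the identifications, the first ones because restriction is onto:
every element of `𝓕 L` extends to `K`. -/
theorem consOmega_eq_map {k : ℕ} {X : Str.{0} S} (g : Hom (consReduction k T.yes T'.yes X) T'.no)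
    {L K : SmallSet X k} (hLK : L.1 ⊆ K.1) [Finite (kConsistency k X T.yes K)]
    [Finite (kConsistency k X T.yes L)] :
    consOmega g L = (omega (Pol T')).map (kConsistency.restrict hLK) (consOmega g K) := by
  have hρ := (kConsistency.restrict_surjective (A := T.yes) hLK)
  refine omega_ext (Pol T') (Set.image_univ_of_surjective hρ).symm _ _
    (fun z => ⟨z.1, (Set.image_univ_of_surjective hρ).symm ▸ z.2⟩) (fun _ => rfl) ?_
  have hL : g.consPow L = (Pol T').map (kConsistency.restrict hLK) (g.consPow K) :=
    Hom.ext_map fun t b => (g.consPow_restrict hLK t b).symm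
  rw [hL]
  rfl

/-- The evaluation of a polymorphism of arity `𝓕 K` at the projections. -/
def evalAssignment {k : ℕ} {X : Str.{0} S} {K : SmallSet X k}
    (p : Hom (T.yes.pow (kConsistency k X T.yes K)) T.no) : Assignment X T.no K.1 :=
  fun x => p.map x.1.1 fun f => f.1 x

theorem isPartialHom_evalAssignment {k : ℕ} {X : Str.{0} S} {K : SmallSet X k}
    (p : Hom (T.yes.pow (kConsistency k X T.yes K)) T.no) :
    IsPartialHom X T.no (evalAssignment p) := fun R a ha hK =>
  p.map_rel R (fun i f => f.1 ⟨⟨(S.ar R).typ i, a i⟩, hK i⟩) fun f =>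
    (isConsistentSystem_kConsistency k X T.yes).1 K f.1 f.2 R a ha hK

theorem homTo_of_homTo_consReduction {d r : ℕ}
    {ξ : ∀ (X : Type) [Finite X], (omega (Pol T')).obj X → Set ((Pol T).obj X)}
    (hξ : IsDRHom d r (omega (Pol T')) (Pol T) ξ) {k : Fin (r + 1) → ℕ}
    (hk : IsGapSequence T.no d k) {X : Str.{0} S} (hX : X.IsFinite)
    (h : HomTo (consReduction (k 0) T.yes T'.yes X) T'.no) : HomTo X T.no := by
  obtain ⟨g⟩ := h
  have hfin : ∀ K : SmallSet X (k 0), Finite (kConsistency (k 0) X T.yes K) :=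
    finite_kConsistency T.finite_yes
  -- All schemes use the same system `𝓕`, that of `k 0`, so that chains of sets give chains of
  -- minors.
  let up : ∀ i, SmallSet X (k i) → SmallSet X (k 0) :=
    fun i U => ⟨U.1, U.2.trans (hk.1 (Fin.zero_le i))⟩
  refine hk.2 X hX ⟨fun i U => (fun p => evalAssignment (K := up i U) p) ''
    ξ _ (consOmega g (up i U)), fun i U => ⟨?_, ?_⟩, fun U hU => ?_⟩
  · exact (Set.encard_image_le _ _).trans (hξ.card_le _ _)
  · rintro _ ⟨p, -, rfl⟩
    exact isPartialHom_evalAssignment (K := up i U) p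
  · obtain ⟨i, j, hij, p, hp, _, hp', rfl⟩ := hξ.chain
      (fun i => kConsistency (k 0) X T.yes (up i (U i)))
      (fun i => consOmega g (up i (U i)))
      (fun i j hij => kConsistency.restrict (L := up j (U j)) (K := up i (U i)) (hU i j hij.le))
      (fun i j hij => consOmega_eq_map g (L := up j (U j)) (K := up i (U i)) (hU i j hij.le))
      (fun i j k hij hjk => rfl)
    exact ⟨i, j, hij, _, ⟨p, hp, rfl⟩, _, hp', rfl⟩

theorem consReduces_of_isGapSequence {d r : ℕ}
    {ξ : ∀ (X : Type) [Finite X], (omega (Pol T')).obj X → Set ((Pol T).obj X)}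
    (hξ : IsDRHom d r (omega (Pol T')) (Pol T) ξ) {k : Fin (r + 1) → ℕ}
    (hk : IsGapSequence T.no d k) : ConsReduces (k 0) T T' := fun _ hX =>
  ⟨fun h => h.consReduction T'.yes (k 0), mt (homTo_of_homTo_consReduction hξ hk hX)⟩

end

/-! ## Tuples as valuations -/

/-- The positions of type `t` of an arity. -/
abbrev Var {T : Type} (α : Arity T) (t : T) : Type := {i : Fin α.len // α.typ i = t}

section Pull

variable {T : Type} {A : T → Type u} {B : T → Type v} {α β γ : Arity T}

/-- The entry of a tuple at a position of a given type. -/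
def Tuple.val (x : Tuple A α) (t : T) (i : Var α t) : A t := i.2 ▸ x i.1

/-- The tuple of the entries of `x` at the positions `σ`. -/
def Tuple.pull (x : Tuple A α) (σ : Tuple (Var α) β) : Tuple A β := Tuple.map x.val σ

/-- The tuple of all positions of an arity. -/
def Tuple.positions (α : Arity T) : Tuple (Var α) α := fun i => ⟨i, rfl⟩

theorem Tuple.val_map (f : ∀ t, A t → B t) (x : Tuple A α) (t : T) (i : Var α t) :
    Tuple.val (Tuple.map f x) t i = f t (x.val t i) := by
  obtain ⟨i, rfl⟩ := i
  rfl

theorem Tuple.map_pull (f : ∀ t, A t → B t) (x : Tuple A α) (σ : Tuple (Var α) β) :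
    Tuple.map f (x.pull σ) = Tuple.pull (Tuple.map f x) σ :=
  funext fun _ => (Tuple.val_map f x _ _).symm

theorem Tuple.pull_pull (x : Tuple A α) (σ : Tuple (Var α) β) (τ : Tuple (Var β) γ) :
    (x.pull σ).pull τ = x.pull (σ.pull τ) :=
  (Tuple.map_pull x.val σ τ).symm

end Pull

/-! ## The canonical Datalog program -/

instance (S : Sig) : Finite S.Ty := S.finite_ty

instance (S : Sig) : Finite S.Sym := S.finite_sym

/-- The arities of length at most `N`. -/
abbrev SmallArity (S : Sig) (N : ℕ) : Type := {α : Arity S.Ty // α.len ≤ N}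

instance (S : Sig) (N : ℕ) : Finite (SmallArity S N) :=
  Finite.of_surjective
    (fun p : Σ n : Fin (N + 1), Fin n → S.Ty => ⟨⟨p.1, p.2⟩, Nat.le_of_lt_succ p.1.2⟩)
    fun ⟨⟨n, t⟩, h⟩ => ⟨⟨⟨n, Nat.lt_succ_of_le h⟩, t⟩, rfl⟩

section Canonical

variable {S : Sig}

theorem Str.IsFinite.finite_tuple {A : Str.{u} S} (hA : A.IsFinite) (α : Arity S.Ty) :
    Finite (Tuple A.dom α) :=
  have : ∀ i : Fin α.len, Finite (A.dom (α.typ i)) := fun _ => hA _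
  inferInstance

/-- The relations of small arity on `A`, used as the IDB symbols of the canonical program. -/
abbrev SmallRel (A : Str.{0} S) (N : ℕ) : Type := Σ α : SmallArity S N, Set (Tuple A.dom α.1)

theorem finite_smallRel {A : Str.{0} S} (hA : A.IsFinite) (N : ℕ) : Finite (SmallRel A N) :=
  have := hA.finite_tuple
  inferInstance

/-- The arity of a relation of small arity. -/
abbrev SmallRel.arity {A : Str.{0} S} {N : ℕ} (p : SmallRel A N) : Arity S.Ty := p.1.1

/-- The interpretation of the symbols of the canonical program in `A`. -/
def SmallRel.interp (A : Str.{0} S) (N : ℕ) :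
    ∀ s : S.Sym ⊕ SmallRel A N, Set (Tuple A.dom (extArity S SmallRel.arity s))
  | .inl R => A.rel R
  | .inr p => p.2

/-- A rule is valid in `A` if it is satisfied by the relations named by the IDB symbols. -/
def DatalogRule.IsValid {A : Str.{0} S} {N : ℕ}
    (ρ : DatalogRule S (SmallRel.arity (A := A) (N := N))) : Prop :=
  ∀ g : (∀ t, Fin (ρ.vars t) → A.dom t),
    (∀ a ∈ ρ.body, a.Holds (SmallRel.interp A N) g) → Tuple.map g ρ.headArgs ∈ ρ.headSym.2

/-- The rules with at most `N` variables of each type, with the body given by a set. -/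
abbrev CanonicalRule (A : Str.{0} S) (N : ℕ) : Type :=
  Σ (c : S.Ty → Fin (N + 1)) (p : SmallRel A N), Tuple (fun t => Fin (c t)) p.arity ×
    Set (Σ s : S.Sym ⊕ SmallRel A N, Tuple (fun t => Fin (c t)) (extArity S SmallRel.arity s))

theorem finite_canonicalRule {A : Str.{0} S} (hA : A.IsFinite) (N : ℕ) :
    Finite (CanonicalRule A N) :=
  have := finite_smallRel hA N
  inferInstance

theorem finite_canonicalRule_body {A : Str.{0} S} (hA : A.IsFinite) {N : ℕ}
    (ρ : CanonicalRule A N) : ρ.2.2.2.Finite :=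
  have := finite_smallRel hA N
  Set.toFinite _

/-- The Datalog rule given by the data of a canonical rule. -/
noncomputable def CanonicalRule.toRule {A : Str.{0} S} (hA : A.IsFinite) {N : ℕ}
    (ρ : CanonicalRule A N) : DatalogRule S (SmallRel.arity (A := A) (N := N)) where
  vars t := ρ.1 t
  headSym := ρ.2.1
  headArgs := ρ.2.2.1
  body := (finite_canonicalRule_body hA ρ).toFinset.toList.map fun a => Atom.rel a.1 a.2

/-- The canonical Datalog program of width `N` for `A`, which consists of all rules that are valid
in `A`. -/
noncomputable def canonicalProgram {A : Str.{0} S} (hA : A.IsFinite) (N : ℕ) (p : SmallRel A N) :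
    DatalogProgram S where
  idb := SmallRel A N
  finite_idb := finite_smallRel hA N
  idbAr := SmallRel.arity
  rules :=
    have := finite_canonicalRule hA N
    ({ρ : CanonicalRule A N | (ρ.toRule hA).IsValid}.toFinite.toFinset.toList).map fun ρ =>
      ρ.toRule hA
  out := .inr p

theorem mem_rules_canonicalProgram {A : Str.{0} S} {hA : A.IsFinite} {N : ℕ} {p : SmallRel A N}
    {ρ : DatalogRule S (SmallRel.arity (A := A) (N := N))} :
    ρ ∈ (canonicalProgram hA N p).rules ↔
      ∃ ρ' : CanonicalRule A N, (ρ'.toRule hA).IsValid ∧ ρ'.toRule hA = ρ :=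
  List.mem_map.trans (by simp only [Finset.mem_toList, Set.Finite.mem_toFinset, Set.mem_ofPred_eq])

theorem Atom.Holds.mono {T Rel : Type} {ar : Rel → Arity T} {V : T → Type} {A : T → Type u}
    {I J : ∀ R, Set (Tuple A (ar R))} (hIJ : ∀ R, I R ⊆ J R) {h : ∀ t, V t → A t}
    {a : Atom ar V} (ha : a.Holds I h) : a.Holds J h := by
  cases a with
  | rel R x => exact hIJ R ha
  | eq t x y => exact ha

theorem DatalogProgram.isClosedUnder_fixpoint (P : DatalogProgram S) (X : Str.{u} S) :
    P.IsClosedUnder X (P.fixpoint X) := by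
  intro ρ hρ h hbody I hI
  refine hI ρ hρ h fun a ha => (hbody a ha).mono fun R => ?_
  cases R with
  | inl R => exact subset_rfl
  | inr p => exact fun x hx => hx I hI

/-- The tuples for which the canonical program derives the given relation. -/
def Derived {A : Str.{0} S} (hA : A.IsFinite) {N : ℕ} (X : Str.{u} S) (p : SmallRel A N) :
    Set (Tuple X.dom p.arity) :=
  (canonicalProgram hA N p).fixpoint X p

variable {A : Str.{0} S} (hA : A.IsFinite) {N : ℕ} {X : Str.{u} S}

theorem isClosedUnder_canonicalProgram_iff (p q : SmallRel A N)
    (I : ∀ p : SmallRel A N, Set (Tuple X.dom p.arity)) :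
    (canonicalProgram hA N p).IsClosedUnder X I ↔ (canonicalProgram hA N q).IsClosedUnder X I := by
  have h : (canonicalProgram hA N p).interp X I = (canonicalProgram hA N q).interp X I := by
    funext s
    cases s <;> rfl
  unfold DatalogProgram.IsClosedUnder
  rw [h]
  rfl

theorem fixpoint_canonicalProgram (p : SmallRel A N) :
    (canonicalProgram hA N p).fixpoint X = Derived hA X :=
  funext fun q => Set.ext fun _ => forall_congr' fun I =>
    imp_congr_left (isClosedUnder_canonicalProgram_iff hA p q I)

/-- The preimages under `f` of the relations named by the IDB symbols are closed under all valid
rules, so they contain the least fixed point. -/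
theorem Derived.map_mem {p : SmallRel A N} {x : Tuple X.dom p.arity}
    (hx : x ∈ Derived hA X p) (f : Hom X A) : Tuple.map f.map x ∈ p.2 := by
  refine hx (fun p => {x | Tuple.map f.map x ∈ p.2}) fun ρ hρ h hbody => ?_
  obtain ⟨ρ, hvalid, rfl⟩ := mem_rules_canonicalProgram.mp hρ
  refine hvalid (fun t v => f.map t (h t v)) fun a ha => ?_
  have hbody := hbody a ha
  rcases a with ⟨R | q, y⟩ | ⟨t, y, z⟩
  · exact f.map_rel R _ hbody
  · exact hbody
  · exact congrArg (f.map t) hbody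

/-- The tuples of `A` that satisfy all atoms that are derived for `x`. -/
def derivedTuples {α : Arity S.Ty} (x : Tuple X.dom α) : Set (Tuple A.dom α) :=
  {f | (∀ (p : SmallRel A N) (σ : Tuple (Var α) p.arity),
      x.pull σ ∈ Derived hA X p → f.pull σ ∈ p.2) ∧
    ∀ (R : S.Sym) (σ : Tuple (Var α) (S.ar R)), x.pull σ ∈ X.rel R → f.pull σ ∈ A.rel R}

/-- Whatever follows in `A` is derived, because it follows by a single rule: its variables are the
positions of `x`, its body consists of all atoms true for `x` in the fixed point, and its head is
the atom in question. An assignment that satisfies the body is a member of `derivedTuples`, so the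
rule is valid and belongs to the program. -/
theorem pull_mem_derived_iff {α : Arity S.Ty} (hα : α.len ≤ N) (x : Tuple X.dom α)
    (p : SmallRel A N) (σ : Tuple (Var α) p.arity) :
    x.pull σ ∈ Derived hA X p ↔ ∀ f ∈ derivedTuples hA (N := N) x, f.pull σ ∈ p.2 := by
  refine ⟨fun h f hf => hf.1 p σ h, fun hp => ?_⟩
  let e : ∀ t, Var α t ≃ Fin (Nat.card (Var α t)) := fun t => Finite.equivFin _
  have hcard : ∀ t, Nat.card (Var α t) < N + 1 := fun t =>
    Nat.lt_succ_of_le ((Finite.card_subtype_le _).trans (by simpa using hα))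
  let h : ∀ t, Fin (Nat.card (Var α t)) → X.dom t := fun t j => x.val t ((e t).symm j)
  have hpull : ∀ {β : Arity S.Ty} (τ : Tuple (Var α) β),
      Tuple.map h (Tuple.map (fun t => e t) τ) = x.pull τ := fun τ => funext fun i => by
    simp [Tuple.map, Tuple.pull, h]
  let ρ : CanonicalRule A N := ⟨fun t => ⟨Nat.card (Var α t), hcard t⟩, p,
    Tuple.map (fun t => e t) σ,
    {a | Tuple.map h a.2 ∈ (canonicalProgram hA N p).interp X (Derived hA X) a.1}⟩
  have hvalid : (ρ.toRule hA).IsValid := by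
    intro g hg
    have hg' : ∀ (s : S.Sym ⊕ SmallRel A N) (y), Tuple.map h y ∈
        (canonicalProgram hA N p).interp X (Derived hA X) s →
          Tuple.map g y ∈ SmallRel.interp A N s := by
      intro s y hy
      refine hg (Atom.rel s y) ?_
      refine List.mem_map.mpr ⟨⟨s, y⟩, ?_, rfl⟩
      rw [Finset.mem_toList, Set.Finite.mem_toFinset]
      exact hy
    let f : Tuple A.dom α := fun i => g _ (e _ ⟨i, rfl⟩)
    have hf : ∀ {β : Arity S.Ty} (τ : Tuple (Var α) β),
        Tuple.map g (Tuple.map (fun t => e t) τ) = f.pull τ := by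
      intro β τ
      funext i
      change g _ (e _ (τ i)) = f.val _ (τ i)
      generalize τ i = v
      generalize β.typ i = t at v
      obtain ⟨j, rfl⟩ := v
      rfl
    have hfx : f ∈ derivedTuples hA (N := N) x := by
      refine ⟨fun q τ hτ => ?_, fun R τ hτ => ?_⟩
      · rw [← hf]
        refine hg' (.inr q) _ ?_
        change Tuple.map h (Tuple.map (fun t => e t) τ) ∈ Derived hA X q
        rwa [hpull]
      · rw [← hf]
        refine hg' (.inl R) _ ?_
        change Tuple.map h (Tuple.map (fun t => e t) τ) ∈ X.rel R
        rwa [hpull]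
    have := hp f hfx
    rw [← hf] at this
    exact this
  have hclosed := (canonicalProgram hA N p).isClosedUnder_fixpoint X
  rw [fixpoint_canonicalProgram] at hclosed
  have := hclosed (ρ.toRule hA)
    (mem_rules_canonicalProgram.mpr ⟨ρ, hvalid, rfl⟩) h (by
      intro a ha
      obtain ⟨b, hb, rfl⟩ := List.mem_map.mp ha
      rw [Finset.mem_toList, Set.Finite.mem_toFinset] at hb
      exact hb)
  rw [← hpull]
  exact this

theorem mem_derived_iff {p : SmallRel A N} (x : Tuple X.dom p.arity) :
    x ∈ Derived hA X p ↔ derivedTuples hA (N := N) x ⊆ p.2 :=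
  pull_mem_derived_iff hA p.1.2 x p (Tuple.positions p.arity)

/-- For `⊆`, the right-hand side is itself a relation of small arity, hence an IDB symbol, and it is
derived for `x.pull σ`. Applied to subsets, this is both halves of consistency. -/
theorem derivedTuples_pull {α β : Arity S.Ty} (hα : α.len ≤ N) (hβ : β.len ≤ N)
    (x : Tuple X.dom α) (σ : Tuple (Var α) β) :
    derivedTuples hA (N := N) (x.pull σ) = (fun f => f.pull σ) '' derivedTuples hA (N := N) x := by
  apply Set.Subset.antisymm
  · let p : SmallRel A N := ⟨⟨β, hβ⟩, (fun f => f.pull σ) '' derivedTuples hA (N := N) x⟩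
    exact (mem_derived_iff hA (p := p) (x.pull σ)).mp
      ((pull_mem_derived_iff hA hα x p σ).mpr fun f hf => ⟨f, hf, rfl⟩)
  · rintro _ ⟨f, hf, rfl⟩
    refine ⟨fun p τ hτ => ?_, fun R τ hτ => ?_⟩
    · rw [Tuple.pull_pull] at hτ ⊢
      exact hf.1 p _ hτ
    · rw [Tuple.pull_pull] at hτ ⊢
      exact hf.2 R _ hτ

end Canonical

/-! ## Concatenated tuples and tuples of assignments -/

section Concat

variable {T T' : Type} {A : T → Type u} {α : Arity T'} {β : T' → Arity T}

/-- The positions of the `i`-th block of a concatenation of arities. -/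
def Tuple.block (α : Arity T') (β : T' → Arity T) (i : Fin α.len) :
    Tuple (Var (α.concat β)) (β (α.typ i)) :=
  fun j => ⟨finSigmaFinEquiv (⟨i, j⟩ : Σ i : Fin α.len, Fin (β (α.typ i)).len),
    congrArg (fun s : Σ i : Fin α.len, Fin (β (α.typ i)).len => (β (α.typ s.1)).typ s.2)
      (finSigmaFinEquiv.symm_apply_apply (⟨i, j⟩ : Σ i : Fin α.len, Fin (β (α.typ i)).len))⟩

theorem Tuple.concat_pull_block (a : ∀ i : Fin α.len, Tuple A (β (α.typ i))) (i : Fin α.len) :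
    (Tuple.concat a).pull (Tuple.block α β i) = a i := by
  have key : ∀ (s : Σ i, Fin (β (α.typ i)).len) (p : Fin (α.concat β).len)
      (_ : finSigmaFinEquiv.symm p = s) (h : (α.concat β).typ p = (β (α.typ s.1)).typ s.2),
      Tuple.val (Tuple.concat a) _ ⟨p, h⟩ = a s.1 s.2 := by
    rintro s p rfl h
    rfl
  exact funext fun j => key ⟨i, j⟩ _ (Equiv.symm_apply_apply _ _) _

end Concat

section Assignment

variable {S : Sig} {X : Str.{u} S} {A : Str.{v} S}

/-- The arity that lists the types of the elements of a finite set. -/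
noncomputable def setArity (K : Finset X.Elem) : Arity S.Ty :=
  ⟨K.card, fun i => (K.equivFin.symm i).1.1⟩

/-- An assignment as a tuple. -/
noncomputable def Assignment.toTuple {K : Finset X.Elem} (f : Assignment X A K) :
    Tuple A.dom (setArity K) :=
  fun i => f (K.equivFin.symm i)

/-- The position of an element of a finite set. -/
noncomputable def setVar {K : Finset X.Elem} (x : X.Elem) (hx : x ∈ K) : Var (setArity K) x.1 :=
  ⟨K.equivFin ⟨x, hx⟩, by simp [setArity]⟩

/-- A tuple as an assignment. -/
noncomputable def Assignment.ofTuple {K : Finset X.Elem} (f : Tuple A.dom (setArity K)) :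
    Assignment X A K :=
  fun x => f.val x.1.1 (setVar x.1 x.2)

theorem Assignment.toTuple_val {K : Finset X.Elem} (f : Assignment X A K) (x : X.Elem)
    (hx : x ∈ K) : f.toTuple.val x.1 (setVar x hx) = f ⟨x, hx⟩ := by
  have key : ∀ (s : {x // x ∈ K}) (p : Fin K.card) (_ : K.equivFin.symm p = s)
      (h : (setArity K).typ p = s.1.1), Tuple.val f.toTuple _ ⟨p, h⟩ = f s := by
    rintro s p rfl h
    rfl
  exact key ⟨x, hx⟩ _ (Equiv.symm_apply_apply _ _) _

theorem Assignment.ofTuple_toTuple {K : Finset X.Elem} (f : Assignment X A K) :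
    Assignment.ofTuple f.toTuple = f :=
  funext fun x => f.toTuple_val x.1 x.2

theorem Assignment.toTuple_ofTuple {K : Finset X.Elem} (f : Tuple A.dom (setArity K)) :
    (Assignment.ofTuple (X := X) f).toTuple = f := by
  have key : ∀ (i p : Fin K.card) (_ : p = i) (h : (setArity K).typ p = (setArity K).typ i),
      Tuple.val f _ ⟨p, h⟩ = f i := by
    rintro i p rfl h
    rfl
  exact funext fun i => key i _ (Equiv.apply_symm_apply _ _) _

/-- The elements of a finite set as a tuple. -/
noncomputable def setTuple (K : Finset X.Elem) : Tuple X.dom (setArity K) :=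
  Assignment.toTuple (A := X) fun x => x.1.2

/-- The positions of the elements of a subset. -/
noncomputable def setVars {K L : Finset X.Elem} (h : L ⊆ K) :
    Tuple (Var (setArity K)) (setArity L) :=
  fun i => setVar (L.equivFin.symm i).1 (h (L.equivFin.symm i).2)

theorem Assignment.toTuple_pull_setVars {K L : Finset X.Elem} (h : L ⊆ K)
    (f : Assignment X A K) : f.toTuple.pull (setVars h) = (Assignment.restrict h f).toTuple :=
  funext fun i => f.toTuple_val (L.equivFin.symm i).1 _

theorem setTuple_pull_setVars {K L : Finset X.Elem} (h : L ⊆ K) :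
    (setTuple K).pull (setVars h) = setTuple L :=
  Assignment.toTuple_pull_setVars h _

theorem Assignment.ofTuple_pull_setVars {K L : Finset X.Elem} (h : L ⊆ K)
    (f : Tuple A.dom (setArity K)) :
    Assignment.ofTuple (f.pull (setVars h)) = Assignment.restrict h (Assignment.ofTuple f) := by
  conv_lhs => rw [← Assignment.toTuple_ofTuple f]
  rw [Assignment.toTuple_pull_setVars, Assignment.ofTuple_toTuple]

theorem Assignment.toTuple_pull {K : Finset X.Elem} (f : Assignment X A K) {α : Arity S.Ty}
    (a : Tuple X.dom α) (hK : ∀ i, (⟨α.typ i, a i⟩ : X.Elem) ∈ K) :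
    f.toTuple.pull (fun i => setVar ⟨α.typ i, a i⟩ (hK i)) = fun i => f ⟨⟨α.typ i, a i⟩, hK i⟩ :=
  funext fun i => f.toTuple_val ⟨α.typ i, a i⟩ (hK i)

end Assignment

/-- The canonical program of width at least `k` performs `k`-consistency. -/
theorem ofTuple_mem_kConsistency {S : Sig} {A : Str.{0} S} (hA : A.IsFinite) {k N : ℕ}
    (hkN : k ≤ N) {X : Str.{u} S} (K : SmallSet X k) {f : Tuple A.dom (setArity K.1)}
    (hf : f ∈ derivedTuples hA (N := N) (setTuple K.1)) :
    Assignment.ofTuple f ∈ kConsistency k X A K := by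
  refine ⟨fun K => {g | g.toTuple ∈ derivedTuples hA (N := N) (setTuple K.1)},
    ⟨?_, fun L K hLK => ?_⟩, ?_⟩
  · intro K g hg R a ha hK
    rw [← Assignment.toTuple_pull]
    refine hg.2 R _ ?_
    rw [setTuple, Assignment.toTuple_pull]
    exact ha
  · have hD := derivedTuples_pull hA (K.2.trans hkN : (setArity K.1).len ≤ N)
      (L.2.trans hkN : (setArity L.1).len ≤ N) (setTuple K.1) (setVars hLK)
    rw [setTuple_pull_setVars] at hD
    constructor
    · intro h hh
      have hh : h.toTuple ∈ derivedTuples hA (N := N) (setTuple L.1) := hh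
      rw [hD] at hh
      obtain ⟨f, hf, hfh⟩ := hh
      refine ⟨Assignment.ofTuple f, ?_, ?_⟩
      · change (Assignment.ofTuple f).toTuple ∈ derivedTuples hA (N := N) (setTuple K.1)
        rwa [Assignment.toTuple_ofTuple]
      · rw [← Assignment.ofTuple_pull_setVars, ← Assignment.ofTuple_toTuple h]
        exact congrArg _ hfh
    · intro g hg
      change (Assignment.restrict hLK g).toTuple ∈ derivedTuples hA (N := N) (setTuple L.1)
      rw [hD, ← Assignment.toTuple_pull_setVars]
      exact ⟨_, hg, rfl⟩
  · change (Assignment.ofTuple f).toTuple ∈ derivedTuples hA (N := N) (setTuple K.1)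
    rwa [Assignment.toTuple_ofTuple]

/-- Coordinates are changed one at a time; `hrefl` lets the others rest during a step. -/
theorem iff_of_forall_eqvGen {ι : Type u} [Finite ι] {P : ι → Type v} (step : ∀ i, P i → P i → Prop)
    (hrefl : ∀ i a, step i a a) (Q : (∀ i, P i) → Prop)
    (hQ : ∀ y y', (∀ i, step i (y i) (y' i)) → (Q y ↔ Q y')) (y y' : ∀ i, P i)
    (h : ∀ i, Relation.EqvGen (step i) (y i) (y' i)) : Q y ↔ Q y' := by
  classical
  cases nonempty_fintype ι
  have hupdate : ∀ i a a', Relation.EqvGen (step i) a a' →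
      ∀ y, Q (Function.update y i a) ↔ Q (Function.update y i a') := by
    intro i a a' haa' y
    induction haa' with
    | rel a a' haa' =>
      refine hQ _ _ fun j => ?_
      rcases eq_or_ne j i with rfl | hj
      · simpa using haa'
      · simpa [hj] using hrefl j _
    | refl => rfl
    | symm _ _ _ ih => exact ih.symm
    | trans _ _ _ _ _ ih ih' => exact ih.trans ih'
  have hpiece : ∀ s : Finset ι, Q y ↔ Q (s.piecewise y' y) := by
    intro s
    induction s using Finset.induction_on with
    | empty => rw [Finset.piecewise_empty]
    | insert i s hi ih =>
      rw [ih, Finset.piecewise_insert, ← hupdate i (y i) (y' i) (h i)]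
      conv_lhs => rw [← Function.update_eq_self i (s.piecewise y' y)]
      rw [Finset.piecewise_eq_of_notMem _ _ _ hi]
  rw [hpiece Finset.univ, Finset.piecewise_univ]

/-! ## The Datalog reduction -/

theorem HomTo.trans {S : Sig} {A : Str.{u} S} {B : Str.{v} S} {C : Str.{w} S} (h : HomTo A B)
    (h' : HomTo B C) : HomTo A C := by
  obtain ⟨f⟩ := h
  obtain ⟨g⟩ := h'
  exact ⟨⟨fun t a => g.map t (f.map t a), fun R a ha => g.map_rel R _ (f.map_rel R a ha)⟩⟩

section

variable {S S' : Sig}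

/-- The indices of the elements of powers of `B` with exponents among the sets of tuples of `A` of
arities of length at most `k`. -/
abbrev PowIndex (A : Str.{0} S) (B : Str.{0} S') (k : ℕ) (t : S'.Ty) : Type :=
  Σ (τ : SmallArity S k) (F : Set (Tuple A.dom τ.1)), F → B.dom t

theorem finite_powIndex {A : Str.{0} S} {B : Str.{0} S'} (hA : A.IsFinite) (hB : B.IsFinite)
    (k : ℕ) (t : S'.Ty) : Finite (PowIndex A B k t) :=
  have := hA.finite_tuple
  have := hB t
  inferInstance

/-- The intermediate signature of the Datalog reduction. -/
def consSig {A : Str.{0} S} {B : Str.{0} S'} (hA : A.IsFinite) (hB : B.IsFinite) (k : ℕ) :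
    Sig where
  Ty := Σ t, PowIndex A B k t
  Sym := Σ R : S'.Sym, ∀ i : Fin (S'.ar R).len, PowIndex A B k ((S'.ar R).typ i)
  finite_ty := have := finite_powIndex hA hB k; inferInstance
  finite_sym := have := finite_powIndex hA hB k; inferInstance
  ar s := ⟨(S'.ar s.1).len, fun i => ⟨(S'.ar s.1).typ i, s.2 i⟩⟩

variable {A : Str.{0} S} {B : Str.{0} S'} {k N : ℕ}

/-- The relation that defines the domain of an index. -/
abbrev PowIndex.domRel (hkN : k ≤ N) {t : S'.Ty} (e : PowIndex A B k t) : SmallRel A N :=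
  ⟨⟨e.1.1, e.1.2.trans hkN⟩, e.2.1⟩

/-- The concatenation of the arities of a tuple of indices. -/
abbrev powArity (R : S'.Sym) (e : ∀ i : Fin (S'.ar R).len, PowIndex A B k ((S'.ar R).typ i)) :
    Arity S.Ty :=
  Arity.concat (T' := Σ t, PowIndex A B k t)
    ⟨(S'.ar R).len, fun i => ⟨(S'.ar R).typ i, e i⟩⟩ fun s => s.2.1.1

theorem len_powArity_le (hRN : ∀ R, (S'.ar R).len * k ≤ N) (R : S'.Sym)
    (e : ∀ i : Fin (S'.ar R).len, PowIndex A B k ((S'.ar R).typ i)) :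
    (powArity R e).len ≤ N := by
  refine le_trans ?_ (hRN R)
  refine (Finset.sum_le_card_nsmul Finset.univ (fun i => (e i).1.1.len) k
    fun i _ => (e i).1.2).trans ?_
  simp

/-- The concatenation of a tuple of tuples of the arities of indices. -/
abbrev powConcat {D : S.Ty → Type u} (R : S'.Sym)
    {e : ∀ i : Fin (S'.ar R).len, PowIndex A B k ((S'.ar R).typ i)}
    (x : ∀ i, Tuple D (e i).1.1) : Tuple D (powArity R e) :=
  Tuple.concat (T' := Σ t, PowIndex A B k t)
    (α := ⟨(S'.ar R).len, fun i => ⟨(S'.ar R).typ i, e i⟩⟩) (β := fun s => s.2.1.1) x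

/-- The positions of the blocks of a concatenation of the arities of indices. -/
abbrev powBlock (R : S'.Sym) (e : ∀ i : Fin (S'.ar R).len, PowIndex A B k ((S'.ar R).typ i))
    (i : Fin (S'.ar R).len) : Tuple (Var (powArity R e)) (e i).1.1 :=
  Tuple.block (T' := Σ t, PowIndex A B k t)
    ⟨(S'.ar R).len, fun i => ⟨(S'.ar R).typ i, e i⟩⟩ (fun s => s.2.1.1) i

theorem powConcat_pull_powBlock {D : S.Ty → Type u} (R : S'.Sym)
    {e : ∀ i : Fin (S'.ar R).len, PowIndex A B k ((S'.ar R).typ i)}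
    (x : ∀ i, Tuple D (e i).1.1) (i : Fin (S'.ar R).len) :
    (powConcat R x).pull (powBlock R e i) = x i :=
  Tuple.concat_pull_block (T' := Σ t, PowIndex A B k t)
    (α := ⟨(S'.ar R).len, fun i => ⟨(S'.ar R).typ i, e i⟩⟩) (β := fun s => s.2.1.1) x i

/-- The relation that defines the interpretation of a symbol. -/
abbrev powRel (hRN : ∀ R, (S'.ar R).len * k ≤ N) (R : S'.Sym)
    (e : ∀ i : Fin (S'.ar R).len, PowIndex A B k ((S'.ar R).typ i)) : SmallRel A N :=
  ⟨⟨powArity R e, len_powArity_le hRN R e⟩,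
    {g | ∃ h : ∀ i, g.pull (powBlock R e i) ∈ (e i).2.1,
      (fun i => (e i).2.2 ⟨g.pull (powBlock R e i), h i⟩) ∈ B.rel R}⟩

variable (hA : A.IsFinite) (hB : B.IsFinite) (hkN : k ≤ N) (hRN : ∀ R, (S'.ar R).len * k ≤ N)

/-- The Datalog interpretation whose relations are given by the canonical program. -/
noncomputable def consInterpretation : DatalogInterpretation S (consSig (B := B) hA hB k) where
  dom s := canonicalProgram hA N (s.2.domRel hkN)
  rel s := canonicalProgram hA N (powRel hRN s.1 s.2)
  arity_rel _ := rfl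

/-- The union gadget that forgets the indices. -/
def consGadget : UnionGadget (consSig (A := A) (B := B) hA hB k) S' where
  d := Sigma.fst
  r := Sigma.fst
  arity_r _ := rfl

/-- The output of the Datalog reduction. -/
noncomputable def datalogReduction (X : Str.{u} S) : Str.{u} S' :=
  (consGadget (B := B) hA hB).apply ((consInterpretation (N := N) hA hB hkN hRN).apply X)

variable {X : Str.{u} S}

variable (X) in
/-- The elements of type `t` of the output of the Datalog reduction. -/
abbrev PowElem (t : S'.Ty) : Type u :=
  Σ e : PowIndex A B k t, {x : Tuple X.dom e.1.1 // x ∈ Derived hA X (e.domRel hkN)}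

/-- The element of the output of the Datalog reduction. -/
def PowElem.toDom {t : S'.Ty} (y : PowElem (B := B) hA hkN X t) :
    (datalogReduction hA hB hkN hRN X).dom t :=
  ⟨⟨⟨t, y.1⟩, rfl⟩, y.2⟩

/-- The relations of the output of the Datalog reduction. -/
def PowElem.Rel (R : S'.Sym)
    (y : ∀ i : Fin (S'.ar R).len, PowElem (B := B) hA hkN X ((S'.ar R).typ i)) : Prop :=
  powConcat R (fun i => (y i).2.1) ∈ Derived hA X (powRel hRN R fun i => (y i).1)

theorem PowElem.Rel.toDom_mem {R : S'.Sym}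
    {y : ∀ i : Fin (S'.ar R).len, PowElem (B := B) hA hkN X ((S'.ar R).typ i)}
    (h : PowElem.Rel hA hkN hRN R y) :
    (fun i => (y i).toDom hA hB hkN hRN) ∈ (datalogReduction hA hB hkN hRN X).rel R :=
  UnionGadget.Rel.intro (υ := consGadget hA hB)
    (A := (consInterpretation hA hB hkN hRN).apply X) ⟨R, fun i => (y i).1⟩ (fun i => (y i).2) h

theorem HomTo.datalogReduction (h : HomTo X A) : HomTo (datalogReduction hA hB hkN hRN X) B := by
  obtain ⟨f⟩ := h
  refine ⟨⟨fun t y => y.1.2 ▸ y.1.1.2.2.2 ⟨Tuple.map f.map y.2.1, Derived.map_mem hA y.2.2 f⟩, ?_⟩⟩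
  rintro _ _ ⟨⟨R, e⟩, a, ha⟩
  obtain ⟨h, hrel⟩ := Derived.map_mem (p := powRel hRN R e) hA ha f
  have hblock : ∀ i, Tuple.pull (Tuple.map f.map (powConcat R fun i => (a i).1))
      (powBlock R e i) = Tuple.map f.map (a i).1 := fun i =>
    (Tuple.map_pull _ _ _).symm.trans (congrArg _ (powConcat_pull_powBlock R _ i))
  have heq : (fun i => (e i).2.2 ⟨_, h i⟩) = fun i => (e i).2.2
      ⟨Tuple.map f.map (a i).1, Derived.map_mem (p := (e i).domRel hkN) hA (a i).2 f⟩ :=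
    funext fun i => congrArg (e i).2.2 (Subtype.ext (hblock i))
  rw [heq] at hrel
  exact hrel

/-- The element `y'` is obtained from `y` by restriction along a map of positions. -/
def PowElem.Step {t : S'.Ty} (y y' : PowElem (B := B) hA hkN X t) : Prop :=
  ∃ σ : Tuple (Var y.1.1.1) y'.1.1.1, y'.2.1 = y.2.1.pull σ ∧
    ∀ f : y.1.2.1, ∃ h : f.1.pull σ ∈ y'.1.2.1, y'.1.2.2 ⟨f.1.pull σ, h⟩ = y.1.2.2 f

theorem PowElem.Step.refl {t : S'.Ty} (y : PowElem (B := B) hA hkN X t) :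
    PowElem.Step hA hkN y y :=
  ⟨Tuple.positions _, rfl, fun f => ⟨f.2, rfl⟩⟩

theorem PowElem.rel_iff (R : S'.Sym)
    (y : ∀ i : Fin (S'.ar R).len, PowElem (B := B) hA hkN X ((S'.ar R).typ i)) :
    PowElem.Rel hA hkN hRN R y ↔ derivedTuples hA (N := N) (powConcat R fun i => (y i).2.1) ⊆
      (powRel hRN R fun i => (y i).1).2 :=
  mem_derived_iff hA (p := powRel hRN R fun i => (y i).1) _

/-- The maps of positions combine to one map `s` between the concatenations, so by
`derivedTuples_pull` the tuples to be checked for `y'` are those for `y`, pulled along `s`. By the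
definition of a step, both have the same values in `B`. -/
theorem PowElem.rel_iff_of_step (R : S'.Sym)
    (y y' : ∀ i : Fin (S'.ar R).len, PowElem (B := B) hA hkN X ((S'.ar R).typ i))
    (h : ∀ i, PowElem.Step hA hkN (y i) (y' i)) :
    PowElem.Rel hA hkN hRN R y ↔ PowElem.Rel hA hkN hRN R y' := by
  choose σ hx hb using h
  rw [rel_iff, rel_iff]
  let s : Tuple (Var (powArity R fun i => (y i).1)) (powArity R fun i => (y' i).1) :=
    powConcat R fun i => (powBlock R (fun i => (y i).1) i).pull (σ i)
  have hblock : ∀ (g : Tuple A.dom (powArity R fun i => (y i).1)) i,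
      (g.pull s).pull (powBlock R (fun i => (y' i).1) i) =
        (g.pull (powBlock R (fun i => (y i).1) i)).pull (σ i) := fun g i =>
    (powConcat_pull_powBlock R
      (fun i => g.pull ((powBlock R (fun i => (y i).1) i).pull (σ i))) i).trans
      (Tuple.pull_pull g _ _).symm
  have hconcat : powConcat R (fun i => (y' i).2.1) =
      (powConcat R fun i => (y i).2.1).pull s := by
    refine congrArg (powConcat R (e := fun i => (y' i).1)) (a₂ := fun i =>
      (powConcat R fun i => (y i).2.1).pull ((powBlock R (fun i => (y i).1) i).pull (σ i)))
      (funext fun i => ?_)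
    rw [hx i, ← powConcat_pull_powBlock R (fun i => (y i).2.1) i]
    exact Tuple.pull_pull _ _ _
  rw [hconcat, derivedTuples_pull hA (len_powArity_le hRN _ _) (len_powArity_le hRN _ _),
    Set.image_subset_iff]
  refine forall₂_congr fun g hg => ?_
  have hF : ∀ i, g.pull (powBlock R (fun i => (y i).1) i) ∈ (y i).1.2.1 := fun i =>
    (pull_mem_derived_iff hA (len_powArity_le hRN R fun i => (y i).1) _
      ((y i).1.domRel hkN) (powBlock R (fun i => (y i).1) i)).mp
      (by rw [powConcat_pull_powBlock]; exact (y i).2.2) g hg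
  have hF' : ∀ i, (g.pull s).pull (powBlock R (fun i => (y' i).1) i) ∈ (y' i).1.2.1 := fun i => by
    rw [hblock]
    exact (hb i ⟨_, hF i⟩).1
  have heq : (fun i => (y' i).1.2.2 ⟨_, hF' i⟩) = fun i => (y i).1.2.2 ⟨_, hF i⟩ := funext fun i =>
    (congrArg (y' i).1.2.2 (Subtype.ext (hblock g i))).trans (hb i ⟨_, hF i⟩).2
  constructor
  · rintro ⟨_, hrel⟩
    exact ⟨hF', heq ▸ hrel⟩
  · rintro ⟨_, hrel⟩
    exact ⟨hF, heq ▸ hrel⟩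

end

/-! ### Comparison of the two reductions -/

section

variable {S S' : Sig} {A : Str.{0} S} {B : Str.{0} S'} {k N : ℕ} (hA : A.IsFinite)
  (hB : B.IsFinite) (hkN : k ≤ N) (hRN : ∀ R, (S'.ar R).len * k ≤ N) {X : Str.{0} S}

/-- The element given by an element of the consistency reduction before identification. -/
noncomputable def ConsPre.toPowElem {t : S'.Ty} (y : ConsPre k A B X t) :
    PowElem (B := B) hA hkN X t :=
  ⟨⟨⟨setArity y.1.1, y.1.2⟩, derivedTuples hA (N := N) (setTuple y.1.1), fun f =>
      y.2 ⟨Assignment.ofTuple f.1, ofTuple_mem_kConsistency hA hkN y.1 f.2⟩⟩,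
    setTuple y.1.1, (mem_derived_iff hA (p := ⟨⟨setArity y.1.1, y.1.2.trans hkN⟩,
      derivedTuples hA (N := N) (setTuple y.1.1)⟩) _).mpr subset_rfl⟩

theorem ConsIdent.step {t : S'.Ty} {y y' : ConsPre k A B X t} (h : ConsIdent k A B X t y y') :
    PowElem.Step hA hkN (ConsPre.toPowElem hA hkN y) (ConsPre.toPowElem hA hkN y') := by
  obtain ⟨L, K, hLK, b⟩ := h
  refine ⟨setVars hLK, (setTuple_pull_setVars hLK).symm, fun f => ?_⟩
  have hf : f.1.pull (setVars hLK) ∈ derivedTuples hA (N := N) (setTuple L.1) := by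
    rw [← setTuple_pull_setVars hLK, derivedTuples_pull hA (K.2.trans hkN) (L.2.trans hkN)]
    exact ⟨f.1, f.2, rfl⟩
  exact ⟨hf, congrArg b (Subtype.ext (Assignment.ofTuple_pull_setVars hLK f.1))⟩

/-- All blocks list the same set `K`, so the concatenation is a pull of one listing along a diagonal
`δ`. The tuples to be checked therefore have equal blocks `f`, where the claim is the relation of
the power at the coordinate `f`. -/
theorem PowElem.rel_of_mem_pow (R : S'.Sym) (K : SmallSet X k)
    (b : Tuple (B.pow (kConsistency k X A K)).dom (S'.ar R))
    (hb : b ∈ (B.pow (kConsistency k X A K)).rel R) :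
    PowElem.Rel hA hkN hRN R
      fun i => ConsPre.toPowElem (B := B) (t := (S'.ar R).typ i) hA hkN ⟨K, b i⟩ := by
  rw [PowElem.rel_iff]
  let e : ∀ i : Fin (S'.ar R).len, PowIndex A B k ((S'.ar R).typ i) := fun i =>
    (ConsPre.toPowElem (B := B) (t := (S'.ar R).typ i) hA hkN ⟨K, b i⟩).1
  let δ : Tuple (Var (setArity K.1)) (powArity R e) :=
    powConcat R fun _ => Tuple.positions (setArity K.1)
  change derivedTuples hA ((setTuple K.1).pull δ) ⊆ (powRel hRN R e).2
  rw [derivedTuples_pull hA (K.2.trans hkN : (setArity K.1).len ≤ N) (len_powArity_le hRN R e)]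
  rintro _ ⟨f, hf, rfl⟩
  have hblock : ∀ i, (f.pull δ).pull (powBlock R e i) = f := fun i =>
    powConcat_pull_powBlock (e := e) R (fun _ => f) i
  have hmem : ∀ i, (f.pull δ).pull (powBlock R e i) ∈ (e i).2.1 := fun i => by
    rw [hblock]
    exact hf
  refine ⟨hmem, ?_⟩
  have heq : (fun i => (e i).2.2 ⟨_, hmem i⟩) = fun i =>
      b i ⟨Assignment.ofTuple f, ofTuple_mem_kConsistency hA hkN K hf⟩ := funext fun i =>
    congrArg (b i) (Subtype.ext (congrArg Assignment.ofTuple (hblock i)))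
  rw [heq]
  exact hb _

theorem homTo_datalogReduction_of_consReduction :
    HomTo (consReduction k A B X) (datalogReduction hA hB hkN hRN X) := by
  let cls : ∀ t, (consReduction k A B X).dom t →
      Quot (PowElem.Step (B := B) hA hkN (X := X) (t := t)) := fun t =>
    Quot.map (ConsPre.toPowElem hA hkN) fun _ _ h => h.step hA hkN
  -- Identified elements have images that are linked by steps but need not be equal. Any
  -- representative of the class will do, since relations are invariant under steps.
  refine ⟨⟨fun t y => (cls t y).out.toDom hA hB hkN hRN, ?_⟩⟩
  rintro R _ ⟨K, b, hb, rfl⟩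
  refine PowElem.Rel.toDom_mem hA hB hkN hRN ?_
  refine (iff_of_forall_eqvGen (fun i => PowElem.Step hA hkN)
    (fun i => PowElem.Step.refl hA hkN) _ (PowElem.rel_iff_of_step hA hkN hRN R) _ _ fun i => ?_).mp
    (PowElem.rel_of_mem_pow hA hkN hRN R K b hb)
  exact Quot.eqvGen_exact (Quot.out_eq _).symm

end

theorem ConsReduces.dlReduces {S S' : Sig} {T : PromiseTemplate.{u} S}
    {T' : PromiseTemplate.{v} S'} {k : ℕ} (h : ConsReduces k T T') : DLReduces T T' := by
  obtain ⟨M, hM⟩ := (Set.finite_range fun R => (S'.ar R).len).bddAbove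
  -- The width `k + M * k` accommodates the tuples that form the domains, of length at most `k`, and
  -- concatenations of at most `M` of them.
  have hRN : ∀ R, (S'.ar R).len * k ≤ k + M * k := fun R =>
    (Nat.mul_le_mul_right k (hM (Set.mem_range_self R))).trans (Nat.le_add_left _ _)
  refine ⟨_, consInterpretation T.finite_yes T'.finite_yes (Nat.le_add_right _ _) hRN,
    consGadget T.finite_yes T'.finite_yes, fun X hX => ⟨fun hXT => ?_, fun hXT hψ => ?_⟩⟩
  · exact hXT.datalogReduction T.finite_yes T'.finite_yes (Nat.le_add_right _ _) hRN
  · exact (h X hX).2 hXT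
      ((homTo_datalogReduction_of_consReduction T.finite_yes T'.finite_yes _ hRN).trans hψ)

end PCSPReductions

theorem corollaryC4 {S S' : PCSPReductions.Sig}
    (T : PCSPReductions.PromiseTemplate.{u} S) (T' : PCSPReductions.PromiseTemplate.{v} S')
    (d r : ℕ)
    (hξ : ∃ ξ, PCSPReductions.IsDRHom d r
      (PCSPReductions.omega (PCSPReductions.Pol T')) (PCSPReductions.Pol T) ξ) :
    PCSPReductions.DLReduces T T' ∧
    (∃ k : Fin (r + 1) → ℕ, PCSPReductions.IsGapSequence T.no d k ∧ 1 ≤ k 0) ∧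
    (∀ k : Fin (r + 1) → ℕ, PCSPReductions.IsGapSequence T.no d k → 1 ≤ k 0 →
      PCSPReductions.ConsReduces (k 0) T T') := by
  obtain ⟨ξ, hξ⟩ := hξ
  obtain ⟨k, hk, hk0⟩ := PCSPReductions.exists_isGapSequence T.no d r
  exact ⟨(PCSPReductions.consReduces_of_isGapSequence hξ hk).dlReduces, ⟨k, hk, hk0⟩,
    fun _ hk _ => PCSPReductions.consReduces_of_isGapSequence hξ hk⟩
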